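/- Let $p\in L_\infty[0,1]$ be real and uniformly positive ($p\ge c>0$ a.e.), let $q,r\in W_2^{-1}[0,1]$ be real generalized functions, where $W_2^{-1}[0,1]$ is the dual of the complex Sobolev space $W_2^1[0,1]$ with respect to $L_2[0,1]$ (so $q$ is a bounded linear functional $w\mapsto\int_0^1 q\,w\,dx$ on $W_2^1[0,1]$, and it is real if it takes real values on real functions), and let $U$ be a diagonal unitary complex $2\times2$ matrix. Consider the boundary problem $$-(py')'+(q-\lambda r)y=0,\qquad (U-1)y^{\vee}+i(U+1)y^{\wedge}=0,$$ where $y^{\wedge}=(y(0),y(1))^{T}$ and $y^{\vee}=(y^{[1]}(0),-y^{[1]}(1))^{T}$, $y^{[1]}$ being the quasi-derivative, understood in the following variational sense. Put $$\mathfrak H_U=\{y\in W_2^1[0,1] : y^{\wedge}\in\operatorname{im}(U-1)\},$$ with $y$ identified with its continuous representative, let $V$ be the diagonal matrix with $V_{kk}=-\cot\frac{\arg U_{kk}}{2}$ if $U_{kk}\ne1$ and $V_{kk}=0$ if $U_{kk}=1$, and for $\lambda\in\mathbb C$ and $y,z\in\mathfrak H_U$ let $$\langle I^+T(\lambda)y,z\rangle=\int_0^1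 p\,y'\overline{z'}\,dx+\int_0^1(q-\lambda r)\,y\overline z\,dx+\langle Vy^{\wedge},z^{\wedge}\rangle_{\mathbb C^2}.$$ A number $\lambda$ is an eigenvalue, with eigenfunction $y\in\mathfrak H_U\setminus\{0\}$, if $T(\lambda)y=0$, that is, $\langle I^+T(\lambda)y,z\rangle=0$ for all $z\in\mathfrak H_U$. Assume that for some $\xi\in\mathbb R$ the operator $I^+T(\xi)$ is positive, i.e. $\langle I^+T(\xi)y,y\rangle>0$ for every nonzero $y\in\mathfrak H_U$. Let $\lambda_1<\lambda_2<\cdots$ denote the (possibly finite, possibly empty) sequence of the real eigenvalues greater than $\xi$, in increasing order. Let $n\ge2$, suppose that $\lambda_n$ and $\lambda_{n+1}$ exist, and let $y_n,y_{n+1}\in\mathfrak H_U$ be eigenfunctions for $\lambda_n$ and $\lambda_{n+1}$, respectively. Then: 1. if $a<b$ are any two zeros of $y_n$ in $[0,1]$, then $y_{n+1}$ has at least one zero in the open interval $(a,b)$; 2. if $a\in[0,1]$ is any zero of $y_n$, then $y_{n+1}$ has at least one zero in $(0,a)$ provided $a>0$, and at least one zero in $(a,1)$ provided $a<1$. -/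

import Mathlib

open MeasureTheory Set
open scoped Matrix unitInterval ENNReal

noncomputable section

namespace SturmLiouville

/-- A function `f : [0,1] → ℂ` belongs to `W_2^1[0,1]`: it is an indefinite integral of a
square integrable function (this is the continuous representative of its class). -/
def MemW21 (f : I → ℂ) : Prop :=
  ∃ g : ℝ → ℂ, MemLp g 2 (volume.restrict (Icc (0 : ℝ) 1)) ∧
    ∀ t : I, f t = f 0 + ∫ s in (0 : ℝ)..(t : ℝ), g s

theorem intervalIntegrable_of_memLp {g : ℝ → ℂ}
    (hg : MemLp g 2 (volume.restrict (Icc (0 : ℝ) 1))) (t : I) :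
    IntervalIntegrable g volume 0 (t : ℝ) := by
  have h1 : IntegrableOn g (Icc (0 : ℝ) 1) := hg.integrable (by norm_num)
  rw [intervalIntegrable_iff_integrableOn_Ioc_of_le t.2.1]
  exact h1.mono_set (fun x hx => ⟨hx.1.le, hx.2.trans t.2.2⟩)

theorem ac_ofReal {f : ℝ → ℝ} {a b : ℝ} (hf : AbsolutelyContinuousOnInterval f a b) :
    AbsolutelyContinuousOnInterval (fun x => (f x : ℂ)) a b := by
  simpa [AbsolutelyContinuousOnInterval, Complex.dist_of_im_eq, Complex.isometry_ofReal.dist_eq]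
    using hf

/-- The indefinite integral of a square integrable complex function agrees on `[0,1]` with an
absolutely continuous function that has the expected derivative almost everywhere. -/
theorem exists_ac {g : ℝ → ℂ} (hg : MemLp g 2 (volume.restrict (Icc (0 : ℝ) 1))) (c : ℂ) :
    ∃ F : ℝ → ℂ, AbsolutelyContinuousOnInterval F 0 1 ∧
      (∀ t : I, F t = c + ∫ s in (0 : ℝ)..(t : ℝ), g s) ∧
      ∀ᵐ x : ℝ, x ∈ uIcc (0 : ℝ) 1 → HasDerivAt F (g x) x := by
  have h1 : IntervalIntegrable g volume 0 1 := intervalIntegrable_of_memLp hg 1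
  have hre : IntervalIntegrable (fun x => (g x).re) volume 0 1 := ⟨h1.1.re, h1.2.re⟩
  have him : IntervalIntegrable (fun x => (g x).im) volume 0 1 := ⟨h1.1.im, h1.2.im⟩
  have h0 : (0 : ℝ) ∈ uIcc (0 : ℝ) 1 := by simp
  refine ⟨fun x => c + (((∫ s in (0 : ℝ)..x, (g s).re : ℝ) : ℂ) +
    Complex.I • ((∫ s in (0 : ℝ)..x, (g s).im : ℝ) : ℂ)), ?_, ?_, ?_⟩
  · refine AbsolutelyContinuousOnInterval.fun_add ?_ (AbsolutelyContinuousOnInterval.fun_add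
      (ac_ofReal (hre.absolutelyContinuousOnInterval_intervalIntegral h0))
      ((ac_ofReal (him.absolutelyContinuousOnInterval_intervalIntegral h0)).const_smul Complex.I))
    simpa [AbsolutelyContinuousOnInterval] using tendsto_const_nhds
  · intro t
    have ht := intervalIntegrable_of_memLp hg t
    have e1 := Complex.reCLM.intervalIntegral_comp_comm ht
    have e2 := Complex.imCLM.intervalIntegral_comp_comm ht
    simp only [Complex.reCLM_apply, Complex.imCLM_apply] at e1 e2
    simp only [e1, e2]
    congr 1
    apply Complex.ext <;> simp
  · filter_upwards [hre.ae_hasDerivAt_integral, him.ae_hasDerivAt_integral] with x h2 h3 hx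
    have := (((h2 hx 0 h0).ofReal_comp).add
      (((h3 hx 0 h0).ofReal_comp).const_smul Complex.I)).const_add c
    convert! this using 1
    apply Complex.ext <;> simp

theorem MemW21.mul {f h : I → ℂ} (hf : MemW21 f) (hh : MemW21 h) : MemW21 (f * h) := by
  obtain ⟨a, ha, hfa⟩ := hf
  obtain ⟨b, hb, hhb⟩ := hh
  obtain ⟨F, hF, hFf, hFd⟩ := exists_ac ha (f 0)
  obtain ⟨H, hH, hHh, hHd⟩ := exists_ac hb (h 0)
  have bdd : ∀ {G : ℝ → ℂ}, AbsolutelyContinuousOnInterval G 0 1 →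
      MemLp G ∞ (volume.restrict (Icc (0 : ℝ) 1)) := by
    intro G hG
    obtain ⟨C, hC⟩ := hG.exists_bound
    have hc := hG.continuousOn
    rw [uIcc_of_le zero_le_one] at hC hc
    exact memLp_top_of_bound (hc.aestronglyMeasurable measurableSet_Icc) C
      ((ae_restrict_iff' measurableSet_Icc).2 (Filter.Eventually.of_forall hC))
  have hk : MemLp (fun x => a x * H x + F x * b x) 2 (volume.restrict (Icc (0 : ℝ) 1)) :=
    ((bdd hH).mul' ha).add (hb.mul' (bdd hF))
  obtain ⟨K, hK, hKk, hKd⟩ := exists_ac hk (f 0 * h 0)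
  have hac : AbsolutelyContinuousOnInterval (fun x => F x • H x - K x) 0 1 :=
    (hF.fun_smul hH).fun_sub hK
  obtain ⟨C, hC⟩ := hac.const_of_ae_hasDerivAt_zero (by
    filter_upwards [hFd, hHd, hKd] with x h1 h2 h3 hx
    have := ((h1 hx).mul (h2 hx)).sub (h3 hx)
    convert! this using 1
    ring)
  have mem : ∀ t : I, (t : ℝ) ∈ uIcc (0 : ℝ) 1 := fun t => by
    rw [uIcc_of_le zero_le_one]; exact t.2
  refine ⟨_, hk, fun t => ?_⟩
  have hC0 := hC _ (mem 0)
  have hCt := hC _ (mem t)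
  simp only [smul_eq_mul, hFf, hHh, hKk] at hC0 hCt
  rw [← hfa, ← hhb] at hC0 hCt
  simp only [Icc.coe_zero, intervalIntegral.integral_same, add_zero, sub_self] at hC0
  simp only [Pi.mul_apply]
  rw [← hC0] at hCt
  linear_combination hCt

/-- The complex Sobolev space `W_2^1[0,1]`, an algebra of functions under pointwise
multiplication, with pointwise conjugation as `star`. -/
def W21 : StarSubalgebra ℂ (I → ℂ) where
  carrier := {f | MemW21 f}
  mul_mem' := MemW21.mul
  add_mem' := by
    rintro f h ⟨a, ha, hfa⟩ ⟨b, hb, hhb⟩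
    refine ⟨_, ha.add hb, fun t => ?_⟩
    have := intervalIntegral.integral_add (intervalIntegrable_of_memLp ha t)
      (intervalIntegrable_of_memLp hb t)
    simp only [Pi.add_apply] at this ⊢
    rw [this, hfa t, hhb t]
    ring
  algebraMap_mem' := fun c => ⟨0, MemLp.zero, fun t => by simp [Pi.algebraMap_apply]⟩
  star_mem' := by
    rintro f ⟨a, ha, hfa⟩
    refine ⟨star a, ha.star, fun t => ?_⟩
    simp only [Pi.star_apply]
    rw [hfa t, star_add]
    congr 1
    exact (intervalIntegral.intervalIntegral_conj (f := a)).symm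

/-- The function `y`, extended to the real line by the constants `y(0)` and `y(1)`. -/
def extend01 (y : W21) : ℝ → ℂ := IccExtend (zero_le_one : (0 : ℝ) ≤ 1) (y : I → ℂ)

/-- The derivative `y'`; it exists almost everywhere on `[0,1]` and is square integrable. -/
def deriv01 (y : W21) : ℝ → ℂ := deriv (extend01 y)

/-- The norm of `W_2^1[0,1]`. -/
def normW21 (y : W21) : ℝ :=
  √(∫ t in (0 : ℝ)..1, (‖deriv01 y t‖ ^ 2 + ‖extend01 y t‖ ^ 2))

/-- The space `W_2^{-1}[0,1]`, the dual of `W_2^1[0,1]` with respect to the pivot space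
`L_2[0,1]`: a generalized function `q` is the bounded linear functional
`w ↦ ∫₀¹ q w dx` on `W_2^1[0,1]`. -/
structure WNeg where
  pairing : W21 →ₗ[ℂ] ℂ
  bounded : ∃ C : ℝ, ∀ w : W21, ‖pairing w‖ ≤ C * normW21 w

/-- A generalized function is real if its pairing commutes with complex conjugation, that is,
takes real values on real functions. -/
def WNeg.IsReal (q : WNeg) : Prop := ∀ w : W21, q.pairing (star w) = star (q.pairing w)

/-- The vector `(y(0), y(1))` of boundary values. -/
def bdry (y : W21) : Fin 2 → ℂ := ![(y : I → ℂ) 0, (y : I → ℂ) 1]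

/-- The data of the boundary problem `-(p y')' + (q - λ r) y = 0`,
`(U - 1) y^∨ + i (U + 1) y^∧ = 0`: a uniformly positive `p ∈ L_∞[0,1]`, real
`q, r ∈ W_2^{-1}[0,1]` and a diagonal unitary matrix `U`. -/
structure Problem where
  p : ℝ → ℝ
  p_memLp : MemLp p ∞ (volume.restrict (Icc (0 : ℝ) 1))
  p_unif_pos : ∃ c : ℝ, 0 < c ∧ ∀ᵐ t ∂(volume.restrict (Icc (0 : ℝ) 1)), c ≤ p t
  q : WNeg
  q_real : q.IsReal
  r : WNeg
  r_real : r.IsReal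
  U : Matrix (Fin 2) (Fin 2) ℂ
  U_unitary : U ∈ Matrix.unitaryGroup (Fin 2) ℂ
  U_diag : U.IsDiag

namespace Problem

variable (S : Problem)

/-- The space `H_U = {y ∈ W_2^1[0,1] | y^∧ ∈ im (U - 1)}`. -/
def HU : Submodule ℂ W21 where
  carrier := {y | bdry y ∈ LinearMap.range (S.U - 1).mulVecLin}
  zero_mem' := by
    have : bdry 0 = 0 := by ext k; fin_cases k <;> simp [bdry]
    simp only [mem_ofPred_eq, this]
    exact Submodule.zero_mem _
  add_mem' := by
    intro y z hy hz
    have : bdry (y + z) = bdry y + bdry z := by ext k; fin_cases k <;> simp [bdry]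
    simp only [mem_ofPred_eq, this] at *
    exact Submodule.add_mem _ hy hz
  smul_mem' := by
    intro c y hy
    have : bdry (c • y) = c • bdry y := by ext k; fin_cases k <;> simp [bdry]
    simp only [mem_ofPred_eq, this] at *
    exact Submodule.smul_mem _ c hy

/-- The diagonal matrix `V` with entries `-cot (arg U_kk / 2)` where `U_kk ≠ 1`, and `0` where
`U_kk = 1`. -/
def V : Matrix (Fin 2) (Fin 2) ℂ := by
  classical
  exact Matrix.diagonal fun k =>
    if S.U k k = 1 then 0 else ((-Real.cot (Complex.arg (S.U k k) / 2) : ℝ) : ℂ)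

/-- The sesquilinear form of the pencil `T`: for `y, z ∈ H_U` this is
`⟨I⁺ T(μ) y, z⟩ = ∫₀¹ p y' conj(z') dx + ∫₀¹ (q - μ r) y conj(z) dx + ⟨V y^∧, z^∧⟩`.
It is the polarization of the quadratic form that defines `T(μ)`; as `I⁺` is isometric,
`T(μ) y = 0` means that the form vanishes at `(y, z)` for every `z ∈ H_U`. -/
def form (μ : ℂ) (y z : S.HU) : ℂ :=
  (∫ t in (0 : ℝ)..1, (S.p t : ℂ) * deriv01 (y : W21) t * star (deriv01 (z : W21) t))
    + (S.q.pairing ((y : W21) * star (z : W21)) - μ * S.r.pairing ((y : W21) * star (z : W21)))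
    + (S.V *ᵥ bdry y) ⬝ᵥ star (bdry z)

/-- The operator `I⁺ T(ξ)` on `H_U` is positive: its quadratic form (which is real, because `p`,
`q`, `r`, `V` and `ξ` are) is strictly positive on nonzero vectors. -/
def Positive (ξ : ℝ) : Prop := ∀ y : S.HU, y ≠ 0 → 0 < (S.form (ξ : ℂ) y y).re

/-- `y` is an eigenfunction of the pencil at `μ`: a nonzero solution of `T(μ) y = 0`. -/
def IsEigenfunction (μ : ℂ) (y : S.HU) : Prop := y ≠ 0 ∧ ∀ z : S.HU, S.form μ y z = 0

/-- `μ` is an eigenvalue of the pencil. -/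
def IsEigenvalue (μ : ℂ) : Prop := ∃ y : S.HU, S.IsEigenfunction μ y

/-- `μ` is the eigenvalue `λ_n`, `n ≥ 1`: the `n`-th eigenvalue to the right of `ξ` in
increasing order, that is, there are exactly `n - 1` eigenvalues in the interval `(ξ, μ)`. -/
def IsEigenvalueAbove (ξ : ℝ) (n : ℕ) (μ : ℝ) : Prop :=
  ξ < μ ∧ S.IsEigenvalue (μ : ℂ) ∧
    {ν : ℝ | ν ∈ Ioo ξ μ ∧ S.IsEigenvalue (ν : ℂ)}.encard + 1 = (n : ℕ∞)

/-- The point `a ∈ [0,1]` is a zero of `y`. -/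
def IsZero (y : S.HU) (a : I) : Prop := ((y : W21) : I → ℂ) a = 0

end Problem

end SturmLiouville

end

noncomputable section

namespace SturmLiouville

/-! The proof compares quadratic forms. Write F_μ for the form of the pencil at a real μ, on real
functions. Let η be a real eigenfunction at λ_n, let each of a < b be a zero of η or the
corresponding end of [0,1], and let z equal η on [a,b] and 0 elsewhere. Then z lies in the form
domain and F_{λ_n}(z,z) = F_{λ_n}(η,z) = 0. The form is affine in μ and F_ξ(z,z) > 0 with ξ < λ_n,
so F_μ(z,z) is strictly decreasing in μ, hence negative at λ_{n+1} (`Problem.exists_zero_between`).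
If y_{n+1} were free of zeros in (a,b), say positive there, then testing its equation with
z²/(y_{n+1} + ε) and letting ε → 0 (Picone's argument, `Coeff.form_self_nonneg`) would give
F_{λ_{n+1}}(z,z) ≥ 0, a contradiction (`Coeff.IsSol.exists_zero`).

Since q and r are distributions, everything stays variational. By Riesz
(`WNeg.IsReal.exists_density`), a real q acts as k w(0) + ∫ u w' with u in L², so F_μ becomes ∫ (p
y'z' + u (yz)') plus terms at the ends. Two uniqueness facts are needed: a solution vanishing on an
interval vanishes identically (so z ≠ 0), and so does a solution vanishing at an end of [0,1]
without Dirichlet condition (so y_{n+1} > 0 wherever z ≠ 0). Both follow from an energy estimate on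
short intervals, `Coeff.eq_zero_of_short`.

Eigenfunctions may be complex. Their real and imaginary parts solve the same real problem and are
linearly dependent (`Coeff.IsSol.exists_linearDependent`), so a complex eigenfunction has the zeros
of a real one. -/

/-- Lebesgue measure on `[0,1]`. -/
abbrev vol01 : Measure ℝ := volume.restrict (Icc (0 : ℝ) 1)

/-! ### Indefinite integrals of square integrable functions on [0,1]. -/

theorem memLp_top_of_continuousOn {Y : ℝ → ℝ} (hY : ContinuousOn Y (Icc 0 1)) :
    MemLp Y ∞ vol01 := by
  obtain ⟨C, hC⟩ := isCompact_Icc.exists_bound_of_continuousOn hY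
  exact memLp_top_of_bound (hY.aestronglyMeasurable measurableSet_Icc) C
    ((ae_restrict_iff' measurableSet_Icc).2 (Filter.Eventually.of_forall hC))

theorem intervalIntegrable_of_integrable_vol01 {E : Type*} [NormedAddCommGroup E] {g : ℝ → E}
    (hg : Integrable g vol01) {s t : ℝ} (hs : s ∈ Icc (0 : ℝ) 1) (ht : t ∈ Icc (0 : ℝ) 1) :
    IntervalIntegrable g volume s t := by
  rw [intervalIntegrable_iff]
  exact IntegrableOn.mono_set hg
    (uIoc_subset_uIcc.trans (uIcc_subset_Icc hs ht))

theorem integral_vol01 {E : Type*} [NormedAddCommGroup E] [NormedSpace ℝ E] (g : ℝ → E) :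
    ∫ x, g x ∂vol01 = ∫ x in (0 : ℝ)..1, g x := by
  rw [intervalIntegral.integral_of_le zero_le_one, integral_Icc_eq_integral_Ioc]

/-- Cauchy–Schwarz, read off from the nonnegativity of the variance of `G` about its mean `m`. -/
theorem sq_intervalIntegral_le {G : ℝ → ℝ} {s t : ℝ} (hst : s ≤ t)
    (h1 : IntervalIntegrable G volume s t)
    (h2 : IntervalIntegrable (fun x => G x ^ 2) volume s t) :
    (∫ x in s..t, G x) ^ 2 ≤ (t - s) * ∫ x in s..t, G x ^ 2 := by
  rcases hst.eq_or_lt with rfl | hst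
  · simp
  set m := (∫ x in s..t, G x) / (t - s) with hm
  have hpos : 0 < t - s := sub_pos.2 hst
  have h3 : 0 ≤ ∫ x in s..t, (G x - m) ^ 2 :=
    intervalIntegral.integral_nonneg hst.le fun x _ => sq_nonneg _
  have h4 : ∫ x in s..t, (G x - m) ^ 2
      = (∫ x in s..t, G x ^ 2) - 2 * m * (∫ x in s..t, G x) + m ^ 2 * (t - s) := by
    have : (fun x => (G x - m) ^ 2) = fun x => (G x ^ 2 - 2 * m * G x) + m ^ 2 := by
      ext x; ring
    rw [this, intervalIntegral.integral_add (h2.sub (h1.const_mul _)) (by simp),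
      intervalIntegral.integral_sub h2 (h1.const_mul _), intervalIntegral.integral_const_mul,
      intervalIntegral.integral_const, smul_eq_mul]
    ring
  have h5 : (∫ x in s..t, G x) = m * (t - s) := by rw [hm]; field_simp
  rw [h4, h5] at h3
  rw [h5]
  nlinarith

/-- `Y` is on `[0,1]` an indefinite integral of the square integrable function `G`. -/
def Prim (Y G : ℝ → ℝ) : Prop :=
  MemLp G 2 vol01 ∧ ∀ t ∈ Icc (0 : ℝ) 1, Y t = Y 0 + ∫ s in (0 : ℝ)..t, G s

theorem prim_integral {G : ℝ → ℝ} (c : ℝ) (hG : MemLp G 2 vol01) :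
    Prim (fun t => c + ∫ s in (0 : ℝ)..t, G s) G :=
  ⟨hG, fun t _ => by simp⟩

namespace Prim

variable {Y G Z H : ℝ → ℝ}

theorem integrable (hY : Prim Y G) : Integrable G vol01 := hY.1.integrable (by norm_num)

theorem sub_eq (hY : Prim Y G) {s t : ℝ} (hs : s ∈ Icc (0 : ℝ) 1) (ht : t ∈ Icc (0 : ℝ) 1) :
    Y t - Y s = ∫ x in s..t, G x := by
  have h0 : (0 : ℝ) ∈ Icc (0 : ℝ) 1 := by simp
  rw [hY.2 t ht, hY.2 s hs, ← intervalIntegral.integral_add_adjacent_intervals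
    (intervalIntegrable_of_integrable_vol01 hY.integrable h0 hs)
    (intervalIntegrable_of_integrable_vol01 hY.integrable hs ht)]
  ring

theorem exists_ac (hY : Prim Y G) : ∃ F : ℝ → ℝ, AbsolutelyContinuousOnInterval F 0 1 ∧
    (∀ t ∈ Icc (0 : ℝ) 1, F t = Y t) ∧
    ∀ᵐ x : ℝ, x ∈ uIcc (0 : ℝ) 1 → HasDerivAt F (G x) x := by
  have h0 : (0 : ℝ) ∈ Icc (0 : ℝ) 1 := by simp
  have h1 : IntervalIntegrable G volume 0 1 :=
    intervalIntegrable_of_integrable_vol01 hY.integrable h0 (by simp)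
  refine ⟨fun x => Y 0 + ∫ s in (0 : ℝ)..x, G s, ?_, fun t ht => (hY.2 t ht).symm, ?_⟩
  · refine AbsolutelyContinuousOnInterval.fun_add ?_
      (h1.absolutelyContinuousOnInterval_intervalIntegral (by simp))
    simpa [AbsolutelyContinuousOnInterval] using tendsto_const_nhds
  · filter_upwards [h1.ae_hasDerivAt_integral] with x h2 hx
    exact (h2 hx 0 (by simp)).const_add _

theorem continuousOn (hY : Prim Y G) : ContinuousOn Y (Icc 0 1) := by
  obtain ⟨F, hF, hFY, -⟩ := hY.exists_ac
  have := hF.continuousOn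
  rw [uIcc_of_le zero_le_one] at this
  exact this.congr fun t ht => (hFY t ht).symm

theorem memLp_top (hY : Prim Y G) : MemLp Y ∞ vol01 := memLp_top_of_continuousOn hY.continuousOn

theorem of_ac {F : ℝ → ℝ} (hF : AbsolutelyContinuousOnInterval F 0 1)
    (hd : ∀ᵐ x : ℝ, x ∈ uIcc (0 : ℝ) 1 → HasDerivAt F (G x) x) (hG : MemLp G 2 vol01) :
    Prim F G := by
  refine ⟨hG, fun t ht => ?_⟩
  have hsub : uIcc 0 t ⊆ uIcc (0 : ℝ) 1 := by
    rw [uIcc_of_le ht.1, uIcc_of_le zero_le_one]; exact Icc_subset_Icc_right ht.2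
  have h1 := (hF.mono hsub).integral_deriv_eq_sub
  have h2 : ∫ x in (0 : ℝ)..t, deriv F x = ∫ x in (0 : ℝ)..t, G x := by
    apply intervalIntegral.integral_congr_ae
    filter_upwards [hd] with x hx hxt
    exact (hx (hsub (uIoc_subset_uIcc hxt))).deriv
  rw [← h2, h1]; ring

theorem congr_left (hY : Prim Y G) (h : ∀ t ∈ Icc (0 : ℝ) 1, Z t = Y t) : Prim Z G :=
  ⟨hY.1, fun t ht => by rw [h t ht, h 0 (by simp)]; exact hY.2 t ht⟩

theorem mul (hY : Prim Y G) (hZ : Prim Z H) :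
    Prim (fun t => Y t * Z t) (fun t => G t * Z t + Y t * H t) := by
  obtain ⟨F, hF, hFY, hFd⟩ := hY.exists_ac
  obtain ⟨K, hK, hKZ, hKd⟩ := hZ.exists_ac
  have hm : MemLp (fun t => G t * Z t + Y t * H t) 2 vol01 :=
    (hZ.memLp_top.mul' hY.1).add (hZ.1.mul' hY.memLp_top)
  refine (of_ac (hF.fun_mul hK) ?_ hm).congr_left fun t ht => by rw [hFY t ht, hKZ t ht]
  filter_upwards [hFd, hKd] with x h1 h2 hx
  have hx' : x ∈ Icc (0 : ℝ) 1 := by rwa [uIcc_of_le zero_le_one] at hx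
  have := (h1 hx).mul (h2 hx)
  rwa [hFY x hx', hKZ x hx'] at this

theorem add (hY : Prim Y G) (hZ : Prim Z H) :
    Prim (fun t => Y t + Z t) (fun t => G t + H t) := by
  obtain ⟨F, hF, hFY, hFd⟩ := hY.exists_ac
  obtain ⟨K, hK, hKZ, hKd⟩ := hZ.exists_ac
  refine (of_ac (hF.fun_add hK) ?_ (hY.1.add hZ.1)).congr_left
    fun t ht => by rw [hFY t ht, hKZ t ht]
  filter_upwards [hFd, hKd] with x h1 h2 hx
  exact (h1 hx).add (h2 hx)

theorem const (c : ℝ) : Prim (fun _ => c) (fun _ => 0) :=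
  ⟨MemLp.zero, fun t _ => by simp⟩

theorem const_mul (c : ℝ) (hY : Prim Y G) : Prim (fun t => c * Y t) (fun t => c * G t) := by
  simpa using (Prim.const c).mul hY

theorem inv (hY : Prim Y G) {ε : ℝ} (hε : 0 < ε) (hpos : ∀ t ∈ Icc (0 : ℝ) 1, ε ≤ Y t) :
    Prim (fun t => (Y t)⁻¹) (fun t => -G t / Y t ^ 2) := by
  obtain ⟨F, hF, hFY, hFd⟩ := hY.exists_ac
  have hFpos : ∀ t ∈ uIcc (0 : ℝ) 1, ε ≤ F t := fun t ht => by
    rw [uIcc_of_le zero_le_one] at ht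
    rw [hFY t ht]; exact hpos t ht
  have hac : AbsolutelyContinuousOnInterval (fun t => (F t)⁻¹) 0 1 := by
    rw [absolutelyContinuousOnInterval_iff] at hF ⊢
    intro η hη
    -- Inversion is Lipschitz with constant `1 / ε ^ 2` on `[ε, ∞)`.
    obtain ⟨δ, hδ, h⟩ := hF (η * ε ^ 2) (by positivity)
    refine ⟨δ, hδ, fun E hE hEδ => ?_⟩
    have h1 := h E hE hEδ
    have h2 : ∑ i ∈ Finset.range E.1, dist (F (E.2 i).1)⁻¹ (F (E.2 i).2)⁻¹ ≤
        ∑ i ∈ Finset.range E.1, dist (F (E.2 i).1) (F (E.2 i).2) / ε ^ 2 := by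
      refine Finset.sum_le_sum fun i hi => ?_
      have hi' := hE.1 i hi
      have a1 := hFpos _ hi'.1
      have a2 := hFpos _ hi'.2
      have b1 : 0 < F (E.2 i).1 := hε.trans_le a1
      have b2 : 0 < F (E.2 i).2 := hε.trans_le a2
      rw [dist_comm, Real.dist_eq, Real.dist_eq, inv_sub_inv b2.ne' b1.ne', abs_div,
        abs_of_pos (mul_pos b2 b1)]
      gcongr
      nlinarith
    rw [← Finset.sum_div] at h2
    refine h2.trans_lt ?_
    rwa [div_lt_iff₀ (by positivity)]
  have hc : MemLp (fun t => -1 / Y t ^ 2) ∞ vol01 := by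
    apply memLp_top_of_continuousOn
    refine continuousOn_const.div (hY.continuousOn.pow 2) fun t ht => ?_
    exact pow_ne_zero 2 (hε.trans_le (hpos t ht)).ne'
  have hm : MemLp (fun t => -G t / Y t ^ 2) 2 vol01 := by
    have : (fun t => -G t / Y t ^ 2) = fun t => G t * (-1 / Y t ^ 2) := by ext t; ring
    rw [this]
    exact hc.mul' hY.1
  refine (of_ac hac ?_ hm).congr_left fun t ht => by rw [hFY t ht]
  filter_upwards [hFd] with x h1 hx
  have hx' : x ∈ Icc (0 : ℝ) 1 := by rwa [uIcc_of_le zero_le_one] at hx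
  have := (h1 hx).inv (hε.trans_le (hFpos x hx)).ne'
  rwa [hFY x hx'] at this

theorem intervalIntegral_indicator {a b : ℝ} (hab : a ≤ b) (ha : 0 ≤ a) {t : ℝ} (ht : 0 ≤ t)
    (G : ℝ → ℝ) :
    ∫ s in (0 : ℝ)..t, (Icc a b).indicator G s = ∫ s in min a t..min b t, G s := by
  rw [intervalIntegral.integral_of_le ht, intervalIntegral.integral_of_le (min_le_min_right _ hab),
    setIntegral_indicator measurableSet_Icc]
  apply setIntegral_congr_set
  have h1 : ∀ᵐ x : ℝ, x ≠ a := by simp [ae_iff]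
  filter_upwards [h1] with x hx
  have : x ∈ Ioc 0 t ∩ Icc a b ↔ x ∈ Ioc (min a t) (min b t) := by
    simp only [mem_inter_iff, mem_Ioc, mem_Icc, min_lt_iff, le_min_iff]
    constructor
    · rintro ⟨⟨h1, h2⟩, h3, h4⟩
      exact ⟨Or.inl (lt_of_le_of_ne h3 (Ne.symm hx)), h4, h2⟩
    · rintro ⟨h1 | h1, h2, h3⟩
      · exact ⟨⟨ha.trans_lt h1, h3⟩, h1.le, h2⟩
      · exact absurd h3 (not_le.2 h1)
  exact propext this

/-- Freezing an indefinite integral outside `[a,b]`. -/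
theorem clamp (hY : Prim Y G) {a b : ℝ} (hab : a ≤ b) (ha : 0 ≤ a) (hb : b ≤ 1) :
    Prim (fun t => Y (max a (min b t))) ((Icc a b).indicator G) := by
  refine ⟨hY.1.indicator measurableSet_Icc, fun t ht => ?_⟩
  rw [intervalIntegral_indicator hab ha ht.1]
  have h0 : max a (min b 0) = a := by simp [ha]
  simp only [h0]
  rcases le_total a t with h | h
  · rw [min_eq_left h, ← hY.sub_eq ⟨ha, hab.trans hb⟩
      ⟨le_min (ha.trans hab) ht.1, (min_le_left _ _).trans hb⟩, max_eq_right (le_min hab h)]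
    ring
  · rw [min_eq_right h, min_eq_right (h.trans hab), max_eq_left h]
    simp

/-- Cutting off an indefinite integral at zeros. -/
theorem cutoff (hY : Prim Y G) {a b : ℝ} (hab : a ≤ b) (ha : 0 ≤ a) (hb : b ≤ 1)
    (hYa : a = 0 ∨ Y a = 0) (hYb : b = 1 ∨ Y b = 0) :
    Prim ((Icc a b).indicator Y) ((Icc a b).indicator G) := by
  have h := hY.clamp hab ha hb
  have h0 : (Icc a b).indicator Y 0 = Y a := by
    rcases ha.eq_or_lt with rfl | ha'
    · rw [indicator_of_mem]; exact ⟨le_rfl, hab⟩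
    · rw [indicator_of_notMem fun h => absurd h.1 (not_le.2 ha')]
      exact (hYa.resolve_left ha'.ne').symm
  -- On [0,1] the cutoff coincides with the clamped function: the frozen value is zero, unless the
  -- cut is at an end of [0,1], beyond which nothing is left.
  refine h.congr_left fun t ht => ?_
  rcases lt_or_ge t a with h1 | h1
  · rw [indicator_of_notMem fun h => absurd h.1 (not_le.2 h1),
      max_eq_left ((min_le_right _ _).trans h1.le)]
    exact (hYa.resolve_left (ht.1.trans_lt h1).ne').symm
  rcases le_or_gt t b with h2 | h2
  · rw [indicator_of_mem (mem_Icc.2 ⟨h1, h2⟩), min_eq_right h2, max_eq_right h1]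
  · rw [indicator_of_notMem fun h => absurd h.2 (not_le.2 h2), min_eq_left h2.le, max_eq_right hab]
    exact (hYb.resolve_left (h2.trans_le ht.2).ne).symm

theorem sq_sub_le (hY : Prim Y G) {c d s t : ℝ} (hc : 0 ≤ c) (hd : d ≤ 1)
    (hs : s ∈ Icc c d) (ht : t ∈ Icc c d) :
    (Y t - Y s) ^ 2 ≤ (d - c) * ∫ x in c..d, G x ^ 2 := by
  wlog hst : s ≤ t generalizing s t
  · have := this ht hs (le_of_not_ge hst)
    nlinarith
  have hcd : Icc c d ⊆ Icc (0 : ℝ) 1 := Icc_subset_Icc hc hd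
  have hc' : c ∈ Icc c d := ⟨le_rfl, hs.1.trans hs.2⟩
  have hd' : d ∈ Icc c d := ⟨hs.1.trans hs.2, le_rfl⟩
  have hsq : Integrable (fun x => G x ^ 2) vol01 := hY.1.integrable_sq
  have h1 := sq_intervalIntegral_le hst
    (intervalIntegrable_of_integrable_vol01 hY.integrable (hcd hs) (hcd ht))
    (intervalIntegrable_of_integrable_vol01 hsq (hcd hs) (hcd ht))
  rw [hY.sub_eq (hcd hs) (hcd ht)]
  refine h1.trans ?_
  have h2 : ∫ x in s..t, G x ^ 2 ≤ ∫ x in c..d, G x ^ 2 :=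
    intervalIntegral.integral_mono_interval hs.1 hst ht.2
      (Filter.Eventually.of_forall fun x => sq_nonneg _)
      (intervalIntegrable_of_integrable_vol01 hsq (hcd hc') (hcd hd'))
  have h3 : 0 ≤ ∫ x in s..t, G x ^ 2 :=
    intervalIntegral.integral_nonneg hst fun x _ => sq_nonneg _
  have h4 : t - s ≤ d - c := by linarith [hs.1, ht.2]
  have h5 : 0 ≤ d - c := by linarith [hs.1, ht.2]
  gcongr

end Prim

/-! ### Real quadratic forms and uniqueness of weak solutions. -/

theorem setIntegral_vol01 {c d : ℝ} (hc : 0 ≤ c) (hcd : c ≤ d) (hd : d ≤ 1) (f : ℝ → ℝ) :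
    ∫ x in Icc c d, f x ∂vol01 = ∫ x in c..d, f x := by
  rw [Measure.restrict_restrict measurableSet_Icc,
    inter_eq_left.2 (Icc_subset_Icc hc hd), intervalIntegral.integral_of_le hcd,
    integral_Icc_eq_integral_Ioc]

/-- Coefficients of a real quadratic form `∫ (p y'² + u (y²)') + k₀ y(0)² + k₁ y(1)²`. -/
structure Coeff where
  p : ℝ → ℝ
  u : ℝ → ℝ
  k₀ : ℝ
  k₁ : ℝ
  c : ℝ
  c_pos : 0 < c
  p_memLp : MemLp p ∞ vol01
  u_memLp : MemLp u 2 vol01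
  le_p : ∀ᵐ x ∂vol01, c ≤ p x

namespace Coeff

variable (C : Coeff) {Y G Z H : ℝ → ℝ}

/-- The integrand of the bilinear form, with `G = Y'` and `H = Z'`. -/
def integrand (Y G Z H : ℝ → ℝ) (x : ℝ) : ℝ :=
  C.p x * G x * H x + C.u x * (G x * Z x + Y x * H x)

/-- The bilinear form `∫ (p y' z' + u (y z)') + k₀ y(0) z(0) + k₁ y(1) z(1)`, with `G = Y'` and
`H = Z'`. -/
def form (Y G Z H : ℝ → ℝ) : ℝ :=
  ∫ x, C.integrand Y G Z H x ∂vol01 + C.k₀ * (Y 0 * Z 0) + C.k₁ * (Y 1 * Z 1)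

theorem integrable_integrand (hY : Prim Y G) (hZ : Prim Z H) :
    Integrable (C.integrand Y G Z H) vol01 := by
  have h1 : MemLp (fun x => C.p x * G x) 2 vol01 := hY.1.mul' C.p_memLp
  exact (h1.integrable_mul hZ.1).add (C.u_memLp.integrable_mul (hY.mul hZ).1)

theorem form_add_left {Y' G' : ℝ → ℝ} (hY : Prim Y G) (hY' : Prim Y' G') (hZ : Prim Z H) :
    C.form (fun t => Y t + Y' t) (fun t => G t + G' t) Z H
      = C.form Y G Z H + C.form Y' G' Z H := by
  have : C.integrand (fun t => Y t + Y' t) (fun t => G t + G' t) Z H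
      = fun x => C.integrand Y G Z H x + C.integrand Y' G' Z H x := by
    ext x; simp only [integrand]; ring
  simp only [form, this]
  rw [integral_add (C.integrable_integrand hY hZ) (C.integrable_integrand hY' hZ)]
  ring

theorem form_const_mul_left (a : ℝ) :
    C.form (fun t => a * Y t) (fun t => a * G t) Z H = a * C.form Y G Z H := by
  have : C.integrand (fun t => a * Y t) (fun t => a * G t) Z H
      = fun x => a * C.integrand Y G Z H x := by
    ext x; simp only [integrand]; ring
  simp only [form, this]
  rw [integral_const_mul]
  ring

theorem form_comm : C.form Y G Z H = C.form Z H Y G := by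
  have : C.integrand Y G Z H = C.integrand Z H Y G := by
    ext x; simp only [integrand]; ring
  simp only [form, this]
  ring

/-- A function that vanishes at a point of a short interval vanishes on it, if its form with
its difference to one of its values does. -/
theorem eq_zero_of_short (hY : Prim Y G) {c d e e' : ℝ} (hc : 0 ≤ c) (hd : d ≤ 1)
    (he : e ∈ Icc c d) (he' : e' ∈ Icc c d) (hYe : Y e = 0)
    (hshort : 4 * (d - c) * ∫ x, C.u x ^ 2 ∂vol01 < C.c ^ 2)
    (h0 : ∫ x in Icc c d, (C.p x * G x * G x + C.u x * (G x * (Y x - Y e') + Y x * G x)) ∂vol01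
      = 0) : ∀ t ∈ Icc c d, Y t = 0 := by
  have hcd : c ≤ d := he.1.trans he.2
  set N := ∫ x in Icc c d, G x ^ 2 ∂vol01 with hN
  have hN' : N = ∫ x in c..d, G x ^ 2 := setIntegral_vol01 hc hcd hd _
  have hN0 : 0 ≤ N := integral_nonneg fun x => sq_nonneg _
  set M := ∫ x, C.u x ^ 2 ∂vol01 with hM
  have hM' : ∫ x in Icc c d, C.u x ^ 2 ∂vol01 ≤ M :=
    setIntegral_le_integral C.u_memLp.integrable_sq (Filter.Eventually.of_forall fun x => sq_nonneg _)
  have hcpos := C.c_pos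
  have hint := (C.integrable_integrand hY (hY.add (Prim.const (-Y e')))).integrableOn (s := Icc c d)
  -- The integrand is `p G² + u G (2Y - Y e')`. Completing the square costs half of the ellipticity
  -- constant. Since `2Y - Y e'` is `(Y - Y e) + (Y - Y e')` and each square is at most `(d - c) N`,
  -- its square is at most `4 (d - c) N`. On a short interval this forces `N = 0`.
  have key : ∫ x in Icc c d, (C.c / 2 * G x ^ 2 - 2 * ((d - c) * N) / C.c * C.u x ^ 2) ∂vol01 ≤
      ∫ x in Icc c d, (C.p x * G x * G x + C.u x * (G x * (Y x - Y e') + Y x * G x)) ∂vol01 := by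
    refine setIntegral_mono_on_ae
      ((hY.1.integrable_sq.const_mul _).sub (C.u_memLp.integrable_sq.const_mul _)).integrableOn
      ?_ measurableSet_Icc ?_
    · refine hint.congr (Filter.Eventually.of_forall fun x => ?_)
      simp only [integrand]; ring
    · filter_upwards [C.le_p] with x hp hx
      have h1 := hY.sq_sub_le hc hd he hx
      have h2 := hY.sq_sub_le hc hd he' hx
      rw [← hN'] at h1 h2
      rw [hYe, sub_zero] at h1
      have h3 : (2 * Y x - Y e') ^ 2 ≤ 4 * ((d - c) * N) := by
        nlinarith [sq_nonneg (Y x - (Y x - Y e'))]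
      have h4 : 0 ≤ (C.c * G x + C.u x * (2 * Y x - Y e')) ^ 2 / (2 * C.c) := by positivity
      have h5 : (C.c * G x + C.u x * (2 * Y x - Y e')) ^ 2 / (2 * C.c) = C.c / 2 * G x ^ 2
          + C.u x * G x * (2 * Y x - Y e') + C.u x ^ 2 * (2 * Y x - Y e') ^ 2 / (2 * C.c) := by
        field_simp; ring
      have h6 : C.u x ^ 2 * (2 * Y x - Y e') ^ 2 / (2 * C.c)
          ≤ 2 * ((d - c) * N) / C.c * C.u x ^ 2 := by
        rw [div_le_iff₀ (by positivity)]
        have : 2 * ((d - c) * N) / C.c * C.u x ^ 2 * (2 * C.c)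
          = C.u x ^ 2 * (4 * ((d - c) * N)) := by field_simp; ring
        rw [this]
        gcongr
      have h7 : C.c * G x ^ 2 ≤ C.p x * G x ^ 2 := by gcongr
      nlinarith
  rw [h0, integral_sub (hY.1.integrable_sq.const_mul _).integrableOn
    (C.u_memLp.integrable_sq.const_mul _).integrableOn, integral_const_mul, integral_const_mul,
    ← hN] at key
  have h8 : 2 * ((d - c) * N) / C.c * ∫ x in Icc c d, C.u x ^ 2 ∂vol01
      ≤ 2 * ((d - c) * N) / C.c * M := by
    have : 0 ≤ d - c := sub_nonneg.2 hcd
    gcongr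
  have hN00 : N = 0 := by
    by_contra hne
    have hNpos : 0 < N := lt_of_le_of_ne hN0 (Ne.symm hne)
    have h9 : C.c / 2 * N ≤ 2 * ((d - c) * N) / C.c * M := by linarith
    have h10 : 2 * ((d - c) * N) / C.c * M = (4 * (d - c) * M) * N / (2 * C.c) := by
      field_simp; ring
    rw [h10, le_div_iff₀ (by positivity)] at h9
    nlinarith
  intro t ht
  have h1 := hY.sq_sub_le hc hd he ht
  rw [← hN', hN00, hYe] at h1
  nlinarith

theorem _root_.SturmLiouville.Prim.deriv_eq_zero (hY : Prim Y G) {a b : ℝ} (ha : 0 ≤ a)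
    (hb : b ≤ 1) (h0 : ∀ t ∈ Icc a b, Y t = 0) : ∀ᵐ x ∂vol01, x ∈ Icc a b → G x = 0 := by
  obtain ⟨F, -, hFY, hFd⟩ := hY.exists_ac
  rw [ae_restrict_iff' measurableSet_Icc]
  have h1 : ∀ᵐ x : ℝ, x ≠ a := by simp [ae_iff]
  have h2 : ∀ᵐ x : ℝ, x ≠ b := by simp [ae_iff]
  filter_upwards [hFd, h1, h2] with x hd hxa hxb hx hxab
  have hd' := hd (by rwa [uIcc_of_le zero_le_one])
  have hnhds : Icc a b ∈ nhds x :=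
    Icc_mem_nhds (lt_of_le_of_ne hxab.1 (Ne.symm hxa)) (lt_of_le_of_ne hxab.2 hxb)
  have : F =ᶠ[nhds x] fun _ => 0 := by
    filter_upwards [hnhds] with t ht
    rw [hFY t (Icc_subset_Icc ha hb ht), h0 t ht]
  exact (hd'.congr_of_eventuallyEq this.symm).unique (hasDerivAt_const x (0 : ℝ))

/-- The form of a function vanishing on `[a,b]` with a function that differs from it by a
constant on `[c,d]`, is linear on `[a,b]` and vanishes elsewhere. -/
theorem form_eq_setIntegral (hY : Prim Y G) {a b c d m κ : ℝ} (ha : 0 ≤ a) (hb : b ≤ 1)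
    (h0 : ∀ t ∈ Icc a b, Y t = 0) (hZ : ∀ x ∈ Icc c d, Z x = Y x - κ)
    (hZ0 : ∀ x ∈ Icc (0 : ℝ) 1, x ∉ Icc c d → x ∉ Icc a b → Z x = 0)
    (h00 : Y 0 * Z 0 = 0) (h11 : Y 1 * Z 1 = 0) :
    C.form Y G Z (fun x => (Icc c d).indicator G x + m * (Icc a b).indicator 1 x)
      = ∫ x in Icc c d, (C.p x * G x * G x + C.u x * (G x * (Y x - κ) + Y x * G x)) ∂vol01 := by
  rw [form, h00, h11, ← integral_indicator (μ := vol01) measurableSet_Icc]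
  simp only [mul_zero, add_zero]
  apply integral_congr_ae
  filter_upwards [hY.deriv_eq_zero ha hb h0, ae_restrict_mem measurableSet_Icc] with x hG hx
  by_cases hab : x ∈ Icc a b
  · simp only [integrand, hG hab, h0 x hab, indicator_apply]
    simp
  · by_cases hcd : x ∈ Icc c d
    · simp only [integrand, indicator_of_mem hcd, indicator_of_notMem hab, hZ x hcd]
      ring
    · simp only [integrand, indicator_of_notMem hcd, indicator_of_notMem hab, hZ0 x hx hcd hab]
      ring

theorem exists_short : ∃ δ : ℝ, 0 < δ ∧ ∀ c d : ℝ, d ≤ c + δ →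
    4 * (d - c) * ∫ x, C.u x ^ 2 ∂vol01 < C.c ^ 2 := by
  set M := ∫ x, C.u x ^ 2 ∂vol01 with hM
  have hM0 : 0 ≤ M := integral_nonneg fun x => sq_nonneg _
  have hc := C.c_pos
  -- `M + 1` in place of `M` keeps the denominator positive when `u` is zero.
  refine ⟨C.c ^ 2 / (4 * (M + 1)), by positivity, fun c d hcd => ?_⟩
  have h1 : d - c ≤ C.c ^ 2 / (4 * (M + 1)) := by linarith
  rw [le_div_iff₀ (by positivity)] at h1
  rcases le_or_gt (d - c) 0 with h | h
  · nlinarith [pow_pos hc 2]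
  · nlinarith

/-- `Y` is a weak solution with respect to all test functions that vanish at `0` and `1`. -/
def WeakSol (Y G : ℝ → ℝ) : Prop :=
  ∀ Z H : ℝ → ℝ, Prim Z H → Z 0 = 0 → Z 1 = 0 → C.form Y G Z H = 0

variable {C}

theorem WeakSol.step_right (hY : Prim Y G) (hW : C.WeakSol Y G) {a b d : ℝ} (ha : 0 ≤ a)
    (hab : a < b) (hbd : b ≤ d) (hd : d ≤ 1)
    (hshort : 4 * (d - b) * ∫ x, C.u x ^ 2 ∂vol01 < C.c ^ 2)
    (h0 : ∀ t ∈ Icc a b, Y t = 0) : ∀ t ∈ Icc b d, Y t = 0 := by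
  have hb0 : Y b = 0 := h0 b ⟨hab.le, le_rfl⟩
  have hs : b - a ≠ 0 := (sub_pos.2 hab).ne'
  refine C.eq_zero_of_short hY (ha.trans hab.le) hd ⟨le_rfl, hbd⟩ (e' := d) ⟨hbd, le_rfl⟩ hb0
    hshort ?_
  have hlin : Prim (fun t => t) 1 :=
    ⟨memLp_const (1 : ℝ), fun t _ => by simp⟩
  -- The test function is `Y - Y d` on `[b,d]`, so that it reaches 0 at `d`. The jump this leaves at
  -- `b` is removed by a linear ramp from 0 to `-Y d` on `[a,b]`, which costs nothing because `Y`
  -- vanishes there.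
  have hZ := ((hY.clamp hbd (ha.trans hab.le) hd).add ((hlin.clamp hab.le ha
    (hbd.trans hd)).const_mul (-Y d / (b - a)))).add (Prim.const (Y d * a / (b - a)))
  simp only [add_zero] at hZ
  rw [← C.form_eq_setIntegral hY ha (hbd.trans hd) h0 (κ := Y d)
    (m := -Y d / (b - a)) (Z := fun t => Y (max b (min d t)) +
      -Y d / (b - a) * max a (min b t) + Y d * a / (b - a)) ?_ ?_ ?_ ?_]
  · apply hW _ _ hZ
    · rw [min_eq_right (ha.trans (hab.le.trans hbd)), max_eq_left (ha.trans hab.le), hb0,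
        min_eq_right (ha.trans hab.le), max_eq_left ha]
      ring
    · rw [min_eq_left hd, max_eq_right hbd, min_eq_left (hbd.trans hd), max_eq_right hab.le]
      field_simp; ring
  · intro x hx
    rw [min_eq_right hx.2, max_eq_right hx.1, min_eq_left hx.1, max_eq_right hab.le]
    field_simp; ring
  · intro x hx h1 h2
    rcases lt_or_ge x a with h | h
    · rw [min_eq_right (h.le.trans (hab.le.trans hbd)), max_eq_left (h.le.trans hab.le), hb0,
        min_eq_right (h.le.trans hab.le), max_eq_left h.le]
      ring
    · have h3 : b < x := not_le.1 fun h3 => h2 ⟨h, h3⟩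
      have h4 : d < x := not_le.1 fun h4 => h1 ⟨h3.le, h4⟩
      rw [min_eq_left h4.le, max_eq_right hbd, min_eq_left h3.le, max_eq_right hab.le]
      field_simp; ring
  · rw [min_eq_right (ha.trans (hab.le.trans hbd)), max_eq_left (ha.trans hab.le), hb0,
      min_eq_right (ha.trans hab.le), max_eq_left ha]
    ring
  · rw [min_eq_left hd, max_eq_right hbd, min_eq_left (hbd.trans hd), max_eq_right hab.le]
    field_simp; ring

theorem WeakSol.step_left (hY : Prim Y G) (hW : C.WeakSol Y G) {a b c : ℝ} (hc : 0 ≤ c)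
    (hca : c ≤ a) (hab : a < b) (hb : b ≤ 1)
    (hshort : 4 * (a - c) * ∫ x, C.u x ^ 2 ∂vol01 < C.c ^ 2)
    (h0 : ∀ t ∈ Icc a b, Y t = 0) : ∀ t ∈ Icc c a, Y t = 0 := by
  have ha0 : Y a = 0 := h0 a ⟨le_rfl, hab.le⟩
  have hs : b - a ≠ 0 := (sub_pos.2 hab).ne'
  have ha : 0 ≤ a := hc.trans hca
  refine C.eq_zero_of_short hY hc (hab.le.trans hb) ⟨hca, le_rfl⟩ (e' := c) ⟨le_rfl, hca⟩ ha0
    hshort ?_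
  have hlin : Prim (fun t => t) 1 :=
    ⟨memLp_const (1 : ℝ), fun t _ => by simp⟩
  -- Mirror image: `Y - Y c` on `[c,a]`, then a ramp from `-Y c` to 0 on `[a,b]`.
  have hZ := ((hY.clamp hca hc (hab.le.trans hb)).add ((hlin.clamp hab.le ha
    hb).const_mul (Y c / (b - a)))).add (Prim.const (-(Y c * b) / (b - a)))
  simp only [add_zero] at hZ
  have z0 : Y (max c (min a 0)) + Y c / (b - a) * max a (min b 0) + -(Y c * b) / (b - a) = 0 := by
    rw [min_eq_right ha, max_eq_left hc, min_eq_right (ha.trans hab.le), max_eq_left ha]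
    field_simp; ring
  have z1 : Y (max c (min a 1)) + Y c / (b - a) * max a (min b 1) + -(Y c * b) / (b - a) = 0 := by
    rw [min_eq_left (hab.le.trans hb), max_eq_right hca, min_eq_left hb, max_eq_right hab.le, ha0]
    field_simp; ring
  rw [← C.form_eq_setIntegral hY ha hb h0 (κ := Y c)
    (m := Y c / (b - a)) (Z := fun t => Y (max c (min a t)) +
      Y c / (b - a) * max a (min b t) + -(Y c * b) / (b - a)) ?_ ?_ (by rw [z0, mul_zero])
      (by rw [z1, mul_zero])]
  · exact hW _ _ hZ z0 z1
  · intro x hx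
    rw [min_eq_right hx.2, max_eq_right hx.1, min_eq_right (hx.2.trans hab.le), max_eq_left hx.2]
    field_simp; ring
  · intro x hx h1 h2
    rcases lt_or_ge b x with h | h
    · rw [min_eq_left (hab.le.trans h.le), max_eq_right hca, min_eq_left h.le,
        max_eq_right hab.le, ha0]
      field_simp; ring
    · have h3 : x < a := not_le.1 fun h3 => h2 ⟨h3, h⟩
      have h4 : x < c := not_le.1 fun h4 => h1 ⟨h4, h3.le⟩
      rw [min_eq_right h3.le, max_eq_left h4.le, min_eq_right h, max_eq_left h3.le]
      field_simp; ring

/-- Unique continuation from an interval. -/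
theorem WeakSol.eq_zero_of_Icc (hY : Prim Y G) (hW : C.WeakSol Y G) {a b : ℝ} (ha : 0 ≤ a)
    (hab : a < b) (hb : b ≤ 1) (h0 : ∀ t ∈ Icc a b, Y t = 0) :
    ∀ t ∈ Icc (0 : ℝ) 1, Y t = 0 := by
  obtain ⟨δ, hδ, hshort⟩ := C.exists_short
  -- The step length `δ` depends only on the coefficients, so finitely many steps cover [0,1]. The
  -- left end `a` stays fixed, which keeps room for the ramp.
  have right : ∀ n : ℕ, ∀ t, a ≤ t → t ≤ 1 → t ≤ b + n * δ → Y t = 0 := by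
    intro n
    induction n with
    | zero => intro t h1 _ h3; exact h0 t ⟨h1, by simpa using h3⟩
    | succ n ih =>
      intro t h1 h2 h3
      push_cast at h3
      rcases le_or_gt t (b + n * δ) with h | h
      · exact ih t h1 h2 h
      · have hn : 0 ≤ n * δ := by positivity
        exact hW.step_right hY ha (b := b + n * δ) (by linarith) h.le h2
          (hshort _ _ (by linarith)) (fun s hs => ih s hs.1 (hs.2.trans (h.le.trans h2)) hs.2)
          t ⟨h.le, le_rfl⟩
  have left : ∀ n : ℕ, ∀ t, t ≤ b → 0 ≤ t → a - n * δ ≤ t → Y t = 0 := by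
    intro n
    induction n with
    | zero => intro t h1 _ h3; exact h0 t ⟨by simpa using h3, h1⟩
    | succ n ih =>
      intro t h1 h2 h3
      push_cast at h3
      rcases le_or_gt (a - n * δ) t with h | h
      · exact ih t h1 h2 h
      · have hn : 0 ≤ n * δ := by positivity
        exact hW.step_left hY h2 (a := a - n * δ) h.le (by linarith) hb
          (hshort _ _ (by linarith)) (fun s hs => ih s hs.2 (h2.trans (h.le.trans hs.1)) hs.1)
          t ⟨le_rfl, h.le⟩
  obtain ⟨n, hn⟩ := exists_nat_ge (1 / δ)
  rw [div_le_iff₀ hδ] at hn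
  intro t ht
  rcases le_total a t with h | h
  · exact right n t h ht.2 (by linarith [ht.2])
  · exact left n t (h.trans hab.le) ht.1 (by linarith [ht.1, hab.le.trans hb])

/-- Uniqueness for the Cauchy problem at `0`. -/
theorem eq_zero_of_cauchy_zero (hY : Prim Y G)
    (hW : ∀ Z H : ℝ → ℝ, Prim Z H → Z 1 = 0 → C.form Y G Z H = 0) (h0 : Y 0 = 0) :
    ∀ t ∈ Icc (0 : ℝ) 1, Y t = 0 := by
  obtain ⟨δ, hδ, hshort⟩ := C.exists_short
  set d := min δ 1 with hd
  have hd0 : 0 < d := lt_min hδ one_pos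
  have hd1 : d ≤ 1 := min_le_right _ _
  have hW' : C.WeakSol Y G := fun Z H hZ _ h1 => hW Z H hZ h1
  refine hW'.eq_zero_of_Icc hY le_rfl hd0 hd1 ?_
  refine C.eq_zero_of_short hY le_rfl hd1 ⟨le_rfl, hd0.le⟩ (e' := d) ⟨hd0.le, le_rfl⟩ h0
    (hshort _ _ (by simp [hd])) ?_
  have hZ := (hY.clamp hd0.le le_rfl hd1).add (Prim.const (-Y d))
  have z1 : Y (max 0 (min d 1)) + -Y d = 0 := by
    rw [min_eq_left hd1, max_eq_right hd0.le]; ring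
  -- No ramp is needed: the test function need not vanish at 0, so the zero interval may degenerate
  -- to the point 0, with slope `m = 0`. The end term at 0 drops out because `Y 0 = 0`.
  rw [← C.form_eq_setIntegral hY (a := 0) (b := 0) (m := 0) le_rfl zero_le_one
    (fun t ht => by rw [le_antisymm ht.2 ht.1, h0]) (Z := fun t => Y (max 0 (min d t)) + -Y d)
    ?_ ?_ (by rw [h0, zero_mul]) (by rw [z1, mul_zero])]
  · simp only [zero_mul]
    exact hW _ _ hZ z1
  · intro x hx
    rw [min_eq_right hx.2, max_eq_right hx.1]; ring
  · intro x hx h1 _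
    have : d < x := not_le.1 fun h => h1 ⟨hx.1, h⟩
    rw [min_eq_left this.le, max_eq_right hd0.le]; ring

/-- Uniqueness for the Cauchy problem at `1`. -/
theorem eq_zero_of_cauchy_one (hY : Prim Y G)
    (hW : ∀ Z H : ℝ → ℝ, Prim Z H → Z 0 = 0 → C.form Y G Z H = 0) (h0 : Y 1 = 0) :
    ∀ t ∈ Icc (0 : ℝ) 1, Y t = 0 := by
  obtain ⟨δ, hδ, hshort⟩ := C.exists_short
  set c := max (1 - δ) 0 with hc
  have hc1 : c < 1 := max_lt (by linarith) one_pos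
  have hc0 : 0 ≤ c := le_max_right _ _
  have hW' : C.WeakSol Y G := fun Z H hZ h1 _ => hW Z H hZ h1
  refine hW'.eq_zero_of_Icc hY hc0 hc1 le_rfl ?_
  refine C.eq_zero_of_short hY hc0 le_rfl ⟨hc1.le, le_rfl⟩ (e' := c) ⟨le_rfl, hc1.le⟩ h0
    (hshort _ _ (by linarith [le_max_left (1 - δ) 0])) ?_
  have hZ := (hY.clamp hc1.le hc0 le_rfl).add (Prim.const (-Y c))
  have z0 : Y (max c (min 1 0)) + -Y c = 0 := by
    rw [min_eq_right zero_le_one, max_eq_left hc0]; ring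
  rw [← C.form_eq_setIntegral hY (a := 1) (b := 1) (m := 0) zero_le_one le_rfl
    (fun t ht => by rw [le_antisymm ht.2 ht.1, h0]) (Z := fun t => Y (max c (min 1 t)) + -Y c)
    ?_ ?_ (by rw [z0, mul_zero]) (by rw [h0, zero_mul])]
  · simp only [zero_mul]
    exact hW _ _ hZ z0
  · intro x hx
    rw [min_eq_right hx.2, max_eq_right hx.1]; ring
  · intro x hx h1 _
    have : x < c := not_le.1 fun h => h1 ⟨h, hx.2⟩
    rw [min_eq_right hx.2, max_eq_left this.le]; ring

end Coeff

/-! ### Picone's inequality with regularization. -/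

open Filter in
theorem tendsto_regularization {X z : ℝ} (hpos : z ≠ 0 → 0 < X) :
    Tendsto (fun n : ℕ => 1 / ((n : ℝ) + 1) * (X + 1 / ((n : ℝ) + 1))⁻¹ * z) atTop (nhds 0) := by
  by_cases hz : z = 0
  · simp [hz]
  have h1 : Tendsto (fun n : ℕ => 1 / ((n : ℝ) + 1)) atTop (nhds 0) :=
    tendsto_one_div_add_atTop_nhds_zero_nat
  have hX : X + 0 ≠ 0 := by simpa using (hpos hz).ne'
  simpa using (h1.mul ((h1.const_add X).inv₀ hX)).mul_const z

namespace Coeff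

variable (C : Coeff) {X K Y G η E z h : ℝ → ℝ}

/-- Put w = 1/(X + ε), θ = εw and D = h - Kwz. As Xw = 1 - θ, the right-hand side is exactly p D² +
u θ z h + u θ z D, and completing the square in D leaves the stated bound. At ε = 0 this is Picone's
identity, with remainder p D². The form `K + 0` is the derivative that `Prim.add` and `Prim.const`
produce for `X + ε`. -/
theorem picone_pointwise {c p u z h X K ε : ℝ} (hc : 0 < c) (hp : c ≤ p) (hX : 0 ≤ X)
    (hε : 0 < ε) :
    u * (ε * (X + ε)⁻¹ * z) * h - 1 / (4 * c) * (u * (ε * (X + ε)⁻¹ * z)) ^ 2 ≤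
      (p * h * h + u * (h * z + z * h)) -
      (p * K * ((h * z + z * h) * (X + ε)⁻¹ + z * z * (-(K + 0) / (X + ε) ^ 2)) +
        u * (K * (z * z * (X + ε)⁻¹) +
          X * ((h * z + z * h) * (X + ε)⁻¹ + z * z * (-(K + 0) / (X + ε) ^ 2)))) := by
  have hXε : 0 < X + ε := by linarith
  set w := (X + ε)⁻¹ with hw
  have hXw : X * w = 1 - ε * w := by
    rw [hw]; field_simp; ring
  have hdiv : -(K + 0) / (X + ε) ^ 2 = -K * w ^ 2 := by rw [hw]; field_simp; ring
  rw [hdiv]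
  set D := h - K * w * z with hD
  set θ := ε * w with hθ
  have e1 : X * ((h * z + z * h) * w + z * z * (-K * w ^ 2))
      = (1 - θ) * (2 * h * z - z * z * K * w) := by rw [← hXw]; ring
  rw [e1]
  have e2 : (p * h * h + u * (h * z + z * h)) -
      (p * K * ((h * z + z * h) * w + z * z * (-K * w ^ 2)) +
        u * (K * (z * z * w) + (1 - θ) * (2 * h * z - z * z * K * w)))
      = p * D ^ 2 + u * (θ * z) * h + u * (θ * z) * D := by rw [hD]; ring
  rw [e2]
  have h1 : c * D ^ 2 ≤ p * D ^ 2 := by gcongr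
  have h2 : 0 ≤ (2 * c * D + u * (θ * z)) ^ 2 / (4 * c) := by positivity
  have h3 : (2 * c * D + u * (θ * z)) ^ 2 / (4 * c)
      = c * D ^ 2 + u * (θ * z) * D + 1 / (4 * c) * (u * (θ * z)) ^ 2 := by
    field_simp; ring
  linarith

open Filter in
/-- The Picone inequality: a nonnegative function, positive where `z` does not vanish, that
satisfies the equation tested against `z² / (X + ε)`, forces the quadratic form to be nonnegative
at `z`. -/
theorem form_self_nonneg (hX : Prim X K) (hz : Prim z h) (hX0 : ∀ t ∈ Icc (0 : ℝ) 1, 0 ≤ X t)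
    (hpos : ∀ t ∈ Icc (0 : ℝ) 1, z t ≠ 0 → 0 < X t)
    (hsol : ∀ ε : ℝ, 0 < ε → C.form X K (fun t => z t * z t * (X t + ε)⁻¹)
      (fun t => (h t * z t + z t * h t) * (X t + ε)⁻¹
        + z t * z t * (-(K t + 0) / (X t + ε) ^ 2)) = 0) :
    0 ≤ C.form z h z h := by
  set θ : ℕ → ℝ → ℝ := fun n t => 1 / ((n : ℝ) + 1) * (X t + 1 / ((n : ℝ) + 1))⁻¹ with hθ
  have hεpos : ∀ n : ℕ, 0 < 1 / ((n : ℝ) + 1) := fun n => by positivity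
  have hθ0 : ∀ n, ∀ t ∈ Icc (0 : ℝ) 1, 0 ≤ θ n t := fun n t ht => by
    have := hX0 t ht
    have := hεpos n
    simp only [hθ]; positivity
  have hθ1 : ∀ n, ∀ t ∈ Icc (0 : ℝ) 1, θ n t ≤ 1 := fun n t ht => by
    have h1 := hX0 t ht
    have h2 := hεpos n
    simp only [hθ]
    rw [← div_eq_mul_inv, div_le_one (by linarith)]
    linarith
  have hθm : ∀ n, MemLp (fun t => C.u t * (θ n t * z t)) 2 vol01 := fun n => by
    have h1 : Prim (fun t => (X t + 1 / ((n : ℝ) + 1))⁻¹) _ :=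
      (hX.add (Prim.const (1 / ((n : ℝ) + 1)))).inv (hεpos n)
        (fun t ht => by linarith [hX0 t ht])
    have h2 := ((h1.const_mul (1 / ((n : ℝ) + 1))).mul hz).memLp_top
    exact h2.mul' C.u_memLp
  have huz : MemLp (fun t => C.u t * z t) 2 vol01 := hz.memLp_top.mul' C.u_memLp
  set e : ℕ → ℝ → ℝ := fun n t => C.u t * (θ n t * z t) * h t
    - 1 / (4 * C.c) * (C.u t * (θ n t * z t)) ^ 2 with he
  have hei : ∀ n, Integrable (e n) vol01 := fun n =>
    ((hθm n).integrable_mul hz.1).sub ((hθm n).integrable_sq.const_mul _)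
  have hcpos := C.c_pos
  -- The vanishing form from `hsol` is subtracted from the form at `z`. The end terms combine by `z²
  -- - X z² / (X + ε) = θ z²`.
  have hlow : ∀ n, ∫ t, e n t ∂vol01 + C.k₀ * (θ n 0 * z 0 * z 0) + C.k₁ * (θ n 1 * z 1 * z 1)
      ≤ C.form z h z h := by
    intro n
    have hε := hεpos n
    set ε := 1 / ((n : ℝ) + 1) with hεdef
    have hZ : Prim (fun t => z t * z t * (X t + ε)⁻¹) (fun t => (h t * z t + z t * h t) *
        (X t + ε)⁻¹ + z t * z t * (-(K t + 0) / (X t + ε) ^ 2)) :=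
      (hz.mul hz).mul ((hX.add (Prim.const ε)).inv hε (fun t ht => by linarith [hX0 t ht]))
    have h1 : ∫ t, e n t ∂vol01 ≤ ∫ t, (C.integrand z h z h t - C.integrand X K
        (fun t => z t * z t * (X t + ε)⁻¹) (fun t => (h t * z t + z t * h t) *
        (X t + ε)⁻¹ + z t * z t * (-(K t + 0) / (X t + ε) ^ 2)) t) ∂vol01 := by
      refine integral_mono_ae (hei n)
        ((C.integrable_integrand hz hz).sub (C.integrable_integrand hX hZ)) ?_
      filter_upwards [C.le_p, ae_restrict_mem measurableSet_Icc] with t hp ht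
      exact picone_pointwise hcpos hp (hX0 t ht) hε
    rw [integral_sub (C.integrable_integrand hz hz) (C.integrable_integrand hX hZ)] at h1
    have h2 := hsol ε hε
    have h3 : ∀ t ∈ Icc (0 : ℝ) 1, θ n t * z t * z t = z t * z t
        - X t * (z t * z t * (X t + ε)⁻¹) := fun t ht => by
      have : X t + ε ≠ 0 := by have := hX0 t ht; positivity
      simp only [hθ, ← hεdef]
      field_simp; ring
    rw [h3 0 (by simp), h3 1 (by simp)]
    simp only [form] at h2 ⊢
    linarith
  -- `θ n` tends to 0 wherever `z ≠ 0`, since `X > 0` there, and `0 ≤ θ n ≤ 1` supplies the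
  -- integrable majorant.
  have hlim : Tendsto (fun n => ∫ t, e n t ∂vol01 + C.k₀ * (θ n 0 * z 0 * z 0)
      + C.k₁ * (θ n 1 * z 1 * z 1)) atTop (nhds 0) := by
    have hpt : ∀ t ∈ Icc (0 : ℝ) 1, Tendsto (fun n => θ n t * z t) atTop (nhds 0) :=
      fun t ht => tendsto_regularization (hpos t ht)
    have h1 : Tendsto (fun n => ∫ t, e n t ∂vol01) atTop (nhds (∫ _, (0 : ℝ) ∂vol01)) := by
      refine tendsto_integral_of_dominated_convergence
        (fun t => |C.u t * z t * h t| + 1 / (4 * C.c) * (C.u t * z t) ^ 2)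
        (fun n => (hei n).aestronglyMeasurable)
        ((huz.integrable_mul hz.1).abs.add (huz.integrable_sq.const_mul _)) (fun n => ?_) ?_
      · filter_upwards [ae_restrict_mem measurableSet_Icc] with t ht
        have a0 := hθ0 n t ht
        have a1 := hθ1 n t ht
        have a2 : θ n t ^ 2 ≤ 1 := pow_le_one₀ a0 a1
        rw [Real.norm_eq_abs]
        refine (abs_sub _ _).trans ?_
        have e1 : C.u t * (θ n t * z t) * h t = θ n t * (C.u t * z t * h t) := by ring
        have e2 : 1 / (4 * C.c) * (C.u t * (θ n t * z t)) ^ 2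
          = θ n t ^ 2 * (1 / (4 * C.c) * (C.u t * z t) ^ 2) := by ring
        rw [e1, e2, abs_mul, abs_mul (θ n t ^ 2), abs_of_nonneg a0, abs_of_nonneg (sq_nonneg (θ n t)),
          abs_of_nonneg (a := 1 / (4 * C.c) * (C.u t * z t) ^ 2) (by positivity)]
        refine add_le_add (mul_le_of_le_one_left (abs_nonneg _) a1)
          (mul_le_of_le_one_left (by positivity) a2)
      · filter_upwards [ae_restrict_mem measurableSet_Icc] with t ht
        have := (((hpt t ht).const_mul (C.u t)).mul_const (h t)).sub
          ((((hpt t ht).const_mul (C.u t)).pow 2).const_mul (1 / (4 * C.c)))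
        simpa [he] using this
    have h2 := (h1.add (((hpt 0 (by simp)).mul_const (z 0)).const_mul C.k₀)).add
      (((hpt 1 (by simp)).mul_const (z 1)).const_mul C.k₁)
    simpa using h2
  exact le_of_tendsto' hlim hlow

/-! ### Solutions of a boundary problem, their zeros and their uniqueness. -/

/-- A weak solution with respect to all test functions vanishing at `0` if `D₀` holds, and at `1`
if `D₁` holds; these conditions are imposed on the solution itself as well. -/
structure IsSol (D₀ D₁ : Prop) (Y G : ℝ → ℝ) : Prop where
  prim : Prim Y G
  zero : D₀ → Y 0 = 0
  one : D₁ → Y 1 = 0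
  form_eq_zero : ∀ Z H : ℝ → ℝ, Prim Z H → (D₀ → Z 0 = 0) → (D₁ → Z 1 = 0) → C.form Y G Z H = 0

variable {C} {D₀ D₁ : Prop}

theorem IsSol.weakSol (hY : C.IsSol D₀ D₁ Y G) : C.WeakSol Y G :=
  fun Z H hZ h0 h1 => hY.form_eq_zero Z H hZ (fun _ => h0) (fun _ => h1)

theorem IsSol.const_mul (hY : C.IsSol D₀ D₁ Y G) (s : ℝ) :
    C.IsSol D₀ D₁ (fun t => s * Y t) (fun t => s * G t) where
  prim := hY.prim.const_mul s
  zero h := by rw [hY.zero h, mul_zero]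
  one h := by rw [hY.one h, mul_zero]
  form_eq_zero Z H hZ h0 h1 := by
    rw [form_const_mul_left, hY.form_eq_zero Z H hZ h0 h1, mul_zero]

theorem IsSol.add {Y' G' : ℝ → ℝ} (hY : C.IsSol D₀ D₁ Y G) (hY' : C.IsSol D₀ D₁ Y' G') :
    C.IsSol D₀ D₁ (fun t => Y t + Y' t) (fun t => G t + G' t) where
  prim := hY.prim.add hY'.prim
  zero h := by rw [hY.zero h, hY'.zero h, add_zero]
  one h := by rw [hY.one h, hY'.one h, add_zero]
  form_eq_zero Z H hZ h0 h1 := by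
    rw [C.form_add_left hY.prim hY'.prim hZ, hY.form_eq_zero Z H hZ h0 h1,
      hY'.form_eq_zero Z H hZ h0 h1, add_zero]

theorem IsSol.eq_zero_of_zero (hY : C.IsSol D₀ D₁ Y G) (hD : ¬D₀) (h0 : Y 0 = 0) :
    ∀ t ∈ Icc (0 : ℝ) 1, Y t = 0 :=
  eq_zero_of_cauchy_zero hY.prim
    (fun Z H hZ h1 => hY.form_eq_zero Z H hZ (fun h => absurd h hD) (fun _ => h1)) h0

theorem IsSol.eq_zero_of_one (hY : C.IsSol D₀ D₁ Y G) (hD : ¬D₁) (h1 : Y 1 = 0) :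
    ∀ t ∈ Icc (0 : ℝ) 1, Y t = 0 :=
  eq_zero_of_cauchy_one hY.prim
    (fun Z H hZ h0 => hY.form_eq_zero Z H hZ (fun _ => h0) (fun h => absurd h hD)) h1

/-- The form of a solution with its cutoff at zeros is the form of the cutoff with itself. -/
theorem form_cutoff_self {a b : ℝ} :
    C.form ((Icc a b).indicator η) ((Icc a b).indicator E) ((Icc a b).indicator η)
      ((Icc a b).indicator E)
      = C.form η E ((Icc a b).indicator η) ((Icc a b).indicator E) := by
  have h1 : C.integrand ((Icc a b).indicator η) ((Icc a b).indicator E) ((Icc a b).indicator η)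
      ((Icc a b).indicator E)
      = C.integrand η E ((Icc a b).indicator η) ((Icc a b).indicator E) := by
    ext x
    by_cases hx : x ∈ Icc a b <;> simp [integrand, hx]
  have h2 : ∀ x, (Icc a b).indicator η x * (Icc a b).indicator η x
      = η x * (Icc a b).indicator η x := fun x => by
    by_cases hx : x ∈ Icc a b <;> simp [hx]
  simp only [form, h1, h2]

/-- A nonzero solution has a zero between two zeros of a function `η`, also counting the ends of
`[0,1]`, if the quadratic form is negative at the corresponding cutoff of `η`. -/
theorem IsSol.exists_zero (hY : C.IsSol D₀ D₁ Y G)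
    (hη : Prim η E) (hη0 : D₀ → η 0 = 0) (hη1 : D₁ → η 1 = 0) {a b : ℝ} (hab : a < b)
    (ha : 0 ≤ a) (hb : b ≤ 1) (hηa : a = 0 ∨ η a = 0) (hηb : b = 1 ∨ η b = 0)
    (hneg : C.form ((Icc a b).indicator η) ((Icc a b).indicator E) ((Icc a b).indicator η)
      ((Icc a b).indicator E) < 0) : ∃ t ∈ Ioo a b, Y t = 0 := by
  by_contra! hno
  have hsub : Icc a b ⊆ Icc (0 : ℝ) 1 := Icc_subset_Icc ha hb
  obtain ⟨m, hm⟩ : (Ioo a b).Nonempty := nonempty_Ioo.2 hab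
  -- Multiplying by the constant `Y m` normalizes the sign to be positive at `m`, hence on all of
  -- `(a,b)`.
  set y : ℝ → ℝ := fun t => Y m * Y t with hy
  set g : ℝ → ℝ := fun t => Y m * G t with hg
  have hsol : C.IsSol D₀ D₁ y g := hY.const_mul (Y m)
  have hcont : ContinuousOn y (Icc a b) := hsol.prim.continuousOn.mono hsub
  have hym : 0 < y m := mul_self_pos.2 (hno m hm)
  have hyno : ∀ t ∈ Ioo a b, y t ≠ 0 := fun t ht => mul_ne_zero (hno m hm) (hno t ht)
  have hypos : ∀ t ∈ Ioo a b, 0 < y t := by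
    intro t ht
    by_contra! hle
    have hmt : uIcc m t ⊆ Ioo a b := ordConnected_Ioo.uIcc_subset hm ht
    obtain ⟨s, hs, hs0⟩ := intermediate_value_uIcc (hcont.mono (hmt.trans Ioo_subset_Icc_self))
      (show (0 : ℝ) ∈ uIcc (y m) (y t) from ⟨(inf_le_right).trans hle, hym.le.trans le_sup_left⟩)
    exact hyno s (hmt hs) hs0
  have hy0 : ∀ t ∈ Icc a b, 0 ≤ y t := by
    have hcl : IsClosed (Icc a b ∩ y ⁻¹' Ici 0) :=
      hcont.preimage_isClosed_of_isClosed isClosed_Icc isClosed_Ici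
    have h1 : closure (Ioo a b) ⊆ Icc a b ∩ y ⁻¹' Ici 0 :=
      closure_minimal (fun t ht => ⟨Ioo_subset_Icc_self ht, (hypos t ht).le⟩) hcl
    rw [closure_Ioo hab.ne] at h1
    exact fun t ht => (h1 ht).2
  -- Clamping makes the comparison function nonnegative on all of [0,1]. The equation is tested only
  -- against functions supported in `[a,b]`, where nothing has changed.
  have hX := hsol.prim.clamp hab.le ha hb
  have hz := hη.cutoff hab.le ha hb hηa hηb
  have hclamp : ∀ t, max a (min b t) ∈ Icc a b := fun t =>
    ⟨le_max_left _ _, max_le hab.le (min_le_left _ _)⟩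
  have hclamp' : ∀ t ∈ Icc a b, max a (min b t) = t := fun t ht => by
    rw [min_eq_right ht.2, max_eq_right ht.1]
  refine not_le.2 hneg (C.form_self_nonneg hX hz (fun t _ => hy0 _ (hclamp t)) ?_ ?_)
  · intro t ht hzt
    have htab : t ∈ Icc a b := by
      by_contra h; exact hzt (indicator_of_notMem h _)
    rw [indicator_of_mem htab] at hzt
    rw [hclamp' t htab]
    -- The cutoff can be nonzero at `a` only if `a = 0` and no Dirichlet condition holds there. Then
    -- `y 0 = 0` would force `y` to vanish identically. The end `b` is treated likewise.
    rcases htab.1.eq_or_lt with rfl | hat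
    · have ha0 := hηa.resolve_right hzt
      refine lt_of_le_of_ne (hy0 _ htab) fun h => ?_
      rw [ha0] at h hzt
      exact hyno m hm (hsol.eq_zero_of_zero (fun hD => hzt (hη0 hD)) h.symm m
        (hsub (Ioo_subset_Icc_self hm)))
    rcases htab.2.eq_or_lt with rfl | htb
    · have hb1 := hηb.resolve_right hzt
      refine lt_of_le_of_ne (hy0 _ htab) fun h => ?_
      rw [hb1] at h hzt
      exact hyno m hm (hsol.eq_zero_of_one (fun hD => hzt (hη1 hD)) h.symm m
        (hsub (Ioo_subset_Icc_self hm)))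
    · exact hypos t ⟨hat, htb⟩
  · intro ε hε
    have hZ := (hz.mul hz).mul ((hX.add (Prim.const ε)).inv hε
      (fun t _ => by linarith [hy0 _ (hclamp t)]))
    have hz0 : ∀ t, (D₀ ∧ t = 0) ∨ (D₁ ∧ t = 1) → (Icc a b).indicator η t = 0 := by
      intro t ht
      refine indicator_apply_eq_zero.2 fun _ => ?_
      rcases ht with ⟨hD, rfl⟩ | ⟨hD, rfl⟩
      exacts [hη0 hD, hη1 hD]
    have h1 := hsol.form_eq_zero _ _ hZ
      (fun hD => by simp only [hz0 0 (Or.inl ⟨hD, rfl⟩)]; ring)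
      (fun hD => by simp only [hz0 1 (Or.inr ⟨hD, rfl⟩)]; ring)
    refine Eq.trans ?_ h1
    have e1 : ∀ x w : ℝ, y (max a (min b x)) * ((Icc a b).indicator η x *
        (Icc a b).indicator η x * w) = y x * ((Icc a b).indicator η x *
        (Icc a b).indicator η x * w) := fun x w => by
      by_cases hx : x ∈ Icc a b
      · rw [hclamp' x hx]
      · simp [hx]
    simp only [form, e1]
    congr 3
    ext x
    by_cases hx : x ∈ Icc a b
    · simp only [integrand, hclamp' x hx, indicator_of_mem hx]
    · simp [integrand, hx]

/-- Two solutions of the same boundary problem are linearly dependent. -/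
theorem IsSol.exists_linearDependent {Y₁ G₁ Y₂ G₂ : ℝ → ℝ} (h₁ : C.IsSol D₀ D₁ Y₁ G₁)
    (h₂ : C.IsSol D₀ D₁ Y₂ G₂) : ∃ α β : ℝ, (α ≠ 0 ∨ β ≠ 0) ∧
      ∀ t ∈ Icc (0 : ℝ) 1, α * Y₁ t + β * Y₂ t = 0 := by
  have hcomb : ∀ α β : ℝ, C.IsSol D₀ D₁ (fun t => α * Y₁ t + β * Y₂ t)
      (fun t => α * G₁ t + β * G₂ t) := fun α β => (h₁.const_mul α).add (h₂.const_mul β)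
  -- `l₁` and `l₂` are the one free Cauchy datum at 0 of each solution: the value at 0 without
  -- Dirichlet condition, otherwise a weak quasi-derivative, up to sign. The latter is the form with
  -- `W = 1 - t`; any `Z` with `Z 1 = 0` is a multiple of `W` plus an admissible test function.
  obtain ⟨l₁, l₂, hl⟩ : ∃ l₁ l₂ : ℝ, ∀ α β : ℝ, α * l₁ + β * l₂ = 0 →
      ∀ t ∈ Icc (0 : ℝ) 1, α * Y₁ t + β * Y₂ t = 0 := by
    by_cases hD : D₀
    · have hW : Prim (fun t => 1 + (-1) * t) (fun t => 0 + (-1) * 1) :=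
        (Prim.const 1).add (Prim.const_mul (-1) ⟨memLp_const (1 : ℝ), fun t _ => by simp⟩)
      set W : ℝ → ℝ := fun t => 1 + (-1) * t with hWdef
      set w : ℝ → ℝ := fun t => 0 + (-1) * 1 with hw
      refine ⟨C.form Y₁ G₁ W w, C.form Y₂ G₂ W w, fun α β hαβ => ?_⟩
      have hY := hcomb α β
      have hYW : C.form (fun t => α * Y₁ t + β * Y₂ t) (fun t => α * G₁ t + β * G₂ t) W w = 0 := by
        rw [C.form_add_left (h₁.prim.const_mul α) (h₂.prim.const_mul β) hW,
          form_const_mul_left, form_const_mul_left, hαβ]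
      refine eq_zero_of_cauchy_zero (C := C) hY.prim (fun Z H hZ hZ1 => ?_) (hY.zero hD)
      have h3 := hY.form_eq_zero _ _ (hZ.add (hW.const_mul (-Z 0))) (fun _ => by simp [hWdef])
        (fun _ => by simp [hWdef, hZ1])
      rw [form_comm, C.form_add_left hZ (hW.const_mul (-Z 0)) hY.prim, form_const_mul_left,
        C.form_comm (Y := W), hYW, form_comm] at h3
      simpa using h3
    · exact ⟨Y₁ 0, Y₂ 0, fun α β hαβ => (hcomb α β).eq_zero_of_zero hD hαβ⟩
  by_cases hl0 : l₁ = 0 ∧ l₂ = 0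
  · exact ⟨1, 0, Or.inl one_ne_zero, hl 1 0 (by rw [hl0.1, hl0.2]; ring)⟩
  · refine ⟨l₂, -l₁, ?_, hl _ _ (by ring)⟩
    by_contra! h
    exact hl0 ⟨by linarith [h.2], h.1⟩

/-- Two solutions of the same boundary problem have together the zeros of a single one. -/
theorem IsSol.exists_zero_iff {Y₁ G₁ Y₂ G₂ : ℝ → ℝ} (h₁ : C.IsSol D₀ D₁ Y₁ G₁)
    (h₂ : C.IsSol D₀ D₁ Y₂ G₂) : ∃ Y G : ℝ → ℝ, C.IsSol D₀ D₁ Y G ∧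
      ∀ t ∈ Icc (0 : ℝ) 1, Y t = 0 ↔ Y₁ t = 0 ∧ Y₂ t = 0 := by
  obtain ⟨α, β, hne, h0⟩ := h₁.exists_linearDependent h₂
  -- `-β Y₁ + α Y₂` is orthogonal to the relation `α Y₁ + β Y₂ = 0`; both vanish at a point only if
  -- `Y₁` and `Y₂` do.
  refine ⟨_, _, (h₁.const_mul (-β)).add (h₂.const_mul α), fun t ht => ⟨fun h => ?_, fun h => ?_⟩⟩
  · have h3 := h0 t ht
    have h4 : 0 < α ^ 2 + β ^ 2 := by
      rcases hne with h | h <;> positivity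
    have h5 : (α ^ 2 + β ^ 2) * Y₁ t = 0 := by linear_combination α * h3 - β * h
    have h6 : (α ^ 2 + β ^ 2) * Y₂ t = 0 := by linear_combination β * h3 + α * h
    exact ⟨(mul_eq_zero.1 h5).resolve_left h4.ne', (mul_eq_zero.1 h6).resolve_left h4.ne'⟩
  · simp [h.1, h.2]

end Coeff

/-! ### Calculus in `W21`. -/

theorem intervalIntegral_congr_vol01 {E : Type*} [NormedAddCommGroup E] [NormedSpace ℝ E]
    {f g : ℝ → E} (h : f =ᵐ[vol01] g) {t : ℝ} (ht : t ∈ Icc (0 : ℝ) 1) :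
    ∫ s in (0 : ℝ)..t, f s = ∫ s in (0 : ℝ)..t, g s := by
  rw [intervalIntegral.integral_of_le ht.1, intervalIntegral.integral_of_le ht.1]
  exact integral_congr_ae (ae_restrict_of_ae_restrict_of_subset
    (show Ioc 0 t ⊆ Icc (0 : ℝ) 1 from fun x hx => ⟨hx.1.le, hx.2.trans ht.2⟩) h)

theorem extend01_of_mem (y : W21) {t : ℝ} (ht : t ∈ Icc (0 : ℝ) 1) :
    extend01 y t = (y : I → ℂ) ⟨t, ht⟩ := IccExtend_of_mem _ _ ht

theorem extend01_coe (y : W21) (t : I) : extend01 y t = (y : I → ℂ) t := by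
  rw [extend01_of_mem y t.2]

theorem extend01_mul (y z : W21) (t : ℝ) : extend01 (y * z) t = extend01 y t * extend01 z t := rfl

theorem extend01_star (y : W21) (t : ℝ) : extend01 (star y) t = star (extend01 y t) := rfl

theorem hasDerivAt_extend01_of {y : W21} {g : ℝ → ℂ} (hg : MemLp g 2 vol01)
    (h : ∀ t : I, (y : I → ℂ) t = (y : I → ℂ) 0 + ∫ s in (0 : ℝ)..(t : ℝ), g s) :
    ∀ᵐ x ∂vol01, HasDerivAt (extend01 y) (g x) x := by
  obtain ⟨F, -, hF, hFd⟩ := exists_ac hg ((y : I → ℂ) 0)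
  rw [ae_restrict_iff' measurableSet_Icc]
  have h1 : ∀ᵐ x : ℝ, x ≠ 0 := by simp [ae_iff]
  have h2 : ∀ᵐ x : ℝ, x ≠ 1 := by simp [ae_iff]
  filter_upwards [hFd, h1, h2] with x hd hx0 hx1 hx
  have hnhds : Icc (0 : ℝ) 1 ∈ nhds x :=
    Icc_mem_nhds (lt_of_le_of_ne hx.1 (Ne.symm hx0)) (lt_of_le_of_ne hx.2 hx1)
  refine (hd (by rwa [uIcc_of_le zero_le_one])).congr_of_eventuallyEq ?_
  filter_upwards [hnhds] with t ht
  rw [extend01_of_mem y ht, h ⟨t, ht⟩, ← hF ⟨t, ht⟩]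

theorem deriv01_ae_eq_of {y : W21} {g : ℝ → ℂ} (hg : MemLp g 2 vol01)
    (h : ∀ t : I, (y : I → ℂ) t = (y : I → ℂ) 0 + ∫ s in (0 : ℝ)..(t : ℝ), g s) :
    deriv01 y =ᵐ[vol01] g := by
  filter_upwards [hasDerivAt_extend01_of hg h] with x hx
  exact hx.deriv

theorem memLp_deriv01 (y : W21) : MemLp (deriv01 y) 2 vol01 := by
  obtain ⟨g, hg, h⟩ := y.2
  exact hg.ae_eq (deriv01_ae_eq_of hg h).symm

theorem extend01_eq (y : W21) {t : ℝ} (ht : t ∈ Icc (0 : ℝ) 1) :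
    extend01 y t = extend01 y 0 + ∫ s in (0 : ℝ)..t, deriv01 y s := by
  obtain ⟨g, hg, h⟩ := y.2
  rw [intervalIntegral_congr_vol01 (deriv01_ae_eq_of hg h) ht, extend01_of_mem y ht,
    h ⟨t, ht⟩, extend01_of_mem y (by simp : (0 : ℝ) ∈ Icc (0 : ℝ) 1)]
  rfl

theorem hasDerivAt_extend01 (y : W21) : ∀ᵐ x ∂vol01, HasDerivAt (extend01 y) (deriv01 y x) x := by
  obtain ⟨g, hg, h⟩ := y.2
  filter_upwards [hasDerivAt_extend01_of hg h] with x hx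
  exact hx.differentiableAt.hasDerivAt

theorem deriv01_mul (y z : W21) : deriv01 (y * z) =ᵐ[vol01]
    fun x => deriv01 y x * extend01 z x + extend01 y x * deriv01 z x := by
  filter_upwards [hasDerivAt_extend01 y, hasDerivAt_extend01 z] with x h1 h2
  exact (h1.mul h2).deriv

theorem deriv01_star (y : W21) : deriv01 (star y) =ᵐ[vol01] fun x => star (deriv01 y x) := by
  filter_upwards [hasDerivAt_extend01 y] with x h1
  exact h1.star.deriv

/-- The indefinite integral of a square integrable function, as an element of `W_2^1[0,1]`. -/
def primitive (c : ℂ) (g : ℝ → ℂ) (hg : MemLp g 2 vol01) : W21 :=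
  ⟨fun t => c + ∫ s in (0 : ℝ)..(t : ℝ), g s, g, hg, fun t => by simp⟩

theorem deriv01_primitive (c : ℂ) {g : ℝ → ℂ} (hg : MemLp g 2 vol01) :
    deriv01 (primitive c g hg) =ᵐ[vol01] g :=
  deriv01_ae_eq_of hg fun t => by simp [primitive]

theorem extend01_primitive (c : ℂ) {g : ℝ → ℂ} (hg : MemLp g 2 vol01) {t : ℝ}
    (ht : t ∈ Icc (0 : ℝ) 1) :
    extend01 (primitive c g hg) t = c + ∫ s in (0 : ℝ)..t, g s := by
  rw [extend01_of_mem _ ht]; rfl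

theorem continuousOn_extend01 (y : W21) : ContinuousOn (extend01 y) (Icc 0 1) := by
  obtain ⟨g, hg, h⟩ := y.2
  obtain ⟨F, hFac, hF, -⟩ := exists_ac hg ((y : I → ℂ) 0)
  have := hFac.continuousOn
  rw [uIcc_of_le zero_le_one] at this
  refine this.congr fun t ht => ?_
  rw [extend01_of_mem y ht, h ⟨t, ht⟩, ← hF ⟨t, ht⟩]

theorem memLp_extend01 (y : W21) : MemLp (extend01 y) ∞ vol01 := by
  obtain ⟨C, hC⟩ := isCompact_Icc.exists_bound_of_continuousOn (continuousOn_extend01 y)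
  exact memLp_top_of_bound ((continuousOn_extend01 y).aestronglyMeasurable measurableSet_Icc) C
    ((ae_restrict_iff' measurableSet_Icc).2 (Filter.Eventually.of_forall hC))

/-! ### Square integrable densities of generalized functions. -/

theorem norm_sq_Lp (f : Lp ℂ 2 vol01) : ‖f‖ ^ 2 = ∫ x, ‖f x‖ ^ 2 ∂vol01 := by
  have h1 : inner ℂ f f = ∫ x, ((‖f x‖ ^ 2 : ℝ) : ℂ) ∂vol01 := by
    rw [L2.inner_def]
    refine integral_congr_ae (Filter.Eventually.of_forall fun x => ?_)
    simp only [inner_self_eq_norm_sq_to_K]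
    simp
  rw [inner_self_eq_norm_sq_to_K, integral_complex_ofReal] at h1
  exact Complex.ofReal_injective ((Complex.ofReal_pow _ _).trans h1)

/-- The derivative contributes `‖f‖ ^ 2`, and by Cauchy–Schwarz on the unit interval the function
contributes at most as much again. This makes `WNeg.onDeriv` bounded on L². -/
theorem normW21_primitive_le (f : Lp ℂ 2 vol01) :
    normW21 (primitive 0 f (Lp.memLp f)) ≤ √2 * ‖f‖ := by
  have hf := Lp.memLp f
  set w := primitive 0 f hf with hw
  have hn : MemLp (fun x => ‖f x‖) 2 vol01 := hf.norm
  have hb : ∀ t ∈ Icc (0 : ℝ) 1, ‖extend01 w t‖ ^ 2 ≤ ‖f‖ ^ 2 := by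
    intro t ht
    have h0 : (0 : ℝ) ∈ Icc (0 : ℝ) 1 := by simp
    have h1 : ‖extend01 w t‖ ≤ ∫ s in (0 : ℝ)..t, ‖f s‖ := by
      rw [hw, extend01_primitive 0 hf ht, zero_add]
      exact intervalIntegral.norm_integral_le_integral_norm ht.1
    have h2 := (prim_integral 0 hn).sq_sub_le le_rfl le_rfl h0 ht
    simp only [zero_add, intervalIntegral.integral_same, sub_zero, one_mul] at h2
    rw [← integral_vol01, ← norm_sq_Lp] at h2
    exact (pow_le_pow_left₀ (norm_nonneg _) h1 2).trans h2
  have h3 : normW21 w ≤ √(2 * ‖f‖ ^ 2) := by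
    apply Real.sqrt_le_sqrt
    rw [← integral_vol01]
    have i1 : Integrable (fun x => ‖deriv01 w x‖ ^ 2) vol01 := (memLp_deriv01 w).norm.integrable_sq
    have i2 : Integrable (fun x => ‖extend01 w x‖ ^ 2) vol01 :=
      ((memLp_extend01 w).mono_exponent le_top : MemLp _ 2 vol01).norm.integrable_sq
    rw [integral_add i1 i2, two_mul]
    refine add_le_add (le_of_eq ?_) ?_
    · rw [norm_sq_Lp]
      refine integral_congr_ae ?_
      filter_upwards [deriv01_primitive 0 hf] with x hx
      rw [hw, hx]
    · have : ∫ x, ‖extend01 w x‖ ^ 2 ∂vol01 ≤ ∫ _, ‖f‖ ^ 2 ∂vol01 :=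
        integral_mono_ae i2 (integrable_const _)
          ((ae_restrict_iff' measurableSet_Icc).2 (Filter.Eventually.of_forall hb))
      refine this.trans (le_of_eq ?_)
      simp
  rwa [Real.sqrt_mul zero_le_two, Real.sqrt_sq (norm_nonneg _)] at h3

theorem primitive_ext {c : ℂ} {f g : ℝ → ℂ} {hf : MemLp f 2 vol01} {y : W21}
    (h0 : extend01 y 0 = c) (hg : deriv01 y =ᵐ[vol01] g) (h : f =ᵐ[vol01] g) :
    primitive c f hf = y := by
  apply Subtype.ext
  funext t
  rw [← extend01_coe y, extend01_eq y t.2, h0, intervalIntegral_congr_vol01 (hg.trans h.symm) t.2]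
  rfl

theorem extend01_zero_primitive (c : ℂ) {g : ℝ → ℂ} (hg : MemLp g 2 vol01) :
    extend01 (primitive c g hg) 0 = c := by
  rw [extend01_primitive c hg (by simp)]; simp

theorem extend01_add (y z : W21) (t : ℝ) : extend01 (y + z) t = extend01 y t + extend01 z t := rfl

theorem extend01_smul (c : ℂ) (y : W21) (t : ℝ) : extend01 (c • y) t = c * extend01 y t := rfl

theorem deriv01_add (y z : W21) : deriv01 (y + z) =ᵐ[vol01] fun x => deriv01 y x + deriv01 z x := by
  filter_upwards [hasDerivAt_extend01 y, hasDerivAt_extend01 z] with x h1 h2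
  exact (h1.add h2).deriv

theorem deriv01_smul (c : ℂ) (y : W21) : deriv01 (c • y) =ᵐ[vol01] fun x => c * deriv01 y x := by
  filter_upwards [hasDerivAt_extend01 y] with x h1
  exact (h1.const_mul c).deriv

/-- A generalized function as a functional of the derivative of the test function. -/
def WNeg.onDeriv (q : WNeg) : Lp ℂ 2 vol01 →ₗ[ℂ] ℂ where
  toFun f := q.pairing (primitive 0 f (Lp.memLp f))
  map_add' f g := by
    rw [← map_add]
    congr 1
    refine primitive_ext ?_ (deriv01_add _ _) ?_
    · simp only [extend01_add, extend01_zero_primitive, add_zero]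
    · filter_upwards [Lp.coeFn_add f g, deriv01_primitive 0 (Lp.memLp f),
        deriv01_primitive 0 (Lp.memLp g)] with x h1 h2 h3
      rw [h1, h2, h3]; rfl
  map_smul' c f := by
    rw [RingHom.id_apply, ← map_smul]
    congr 1
    refine primitive_ext ?_ (deriv01_smul _ _) ?_
    · simp only [extend01_smul, extend01_zero_primitive, mul_zero]
    · filter_upwards [Lp.coeFn_smul c f, deriv01_primitive 0 (Lp.memLp f)] with x h1 h2
      rw [h1, h2]; rfl

/-- Every `w` is `w(0) • 1` plus the primitive of `w'`. The first part yields the constant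
`q.pairing 1`, the second a bounded functional of `w'` in L², which the Riesz theorem represents. -/
theorem WNeg.exists_density (q : WNeg) : ∃ (v : ℝ → ℂ) (c : ℂ), MemLp v 2 vol01 ∧
    ∀ w : W21, q.pairing w = c * extend01 w 0 + ∫ x, v x * deriv01 w x ∂vol01 := by
  obtain ⟨C, hC⟩ := q.bounded
  have hbd : ∀ f, ‖q.onDeriv f‖ ≤ (|C| * √2) * ‖f‖ := fun f =>
    calc ‖q.onDeriv f‖ ≤ C * normW21 (primitive 0 f (Lp.memLp f)) := hC _
      _ ≤ |C| * normW21 (primitive 0 f (Lp.memLp f)) :=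
        mul_le_mul_of_nonneg_right (le_abs_self C) (Real.sqrt_nonneg _)
      _ ≤ |C| * (√2 * ‖f‖) := mul_le_mul_of_nonneg_left (normW21_primitive_le f) (abs_nonneg C)
      _ = _ := by ring
  set L := q.onDeriv.mkContinuous _ hbd with hL
  set v := (InnerProductSpace.toDual ℂ (Lp ℂ 2 vol01)).symm L with hv
  -- The conjugate appears because the inner product is conjugate-linear in its first argument.
  refine ⟨fun x => star (v x), q.pairing 1, (Lp.memLp v).star, fun w => ?_⟩
  have hw := memLp_deriv01 w
  have h1 : w = extend01 w 0 • (1 : W21) + primitive 0 (hw.toLp _) (Lp.memLp _) := by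
    apply Subtype.ext
    funext t
    rw [← extend01_coe w, extend01_eq w t.2,
      ← intervalIntegral_congr_vol01 hw.coeFn_toLp t.2]
    change _ = extend01 w 0 * 1 + (0 + _)
    rw [mul_one, zero_add]
  have h2 : q.pairing (primitive 0 (hw.toLp _) (Lp.memLp _)) = inner ℂ v (hw.toLp _) := by
    rw [hv, InnerProductSpace.toDual_symm_apply]
    rfl
  conv_lhs => rw [h1]
  rw [map_add, map_smul, h2, L2.inner_def, smul_eq_mul, mul_comm]
  congr 1
  refine integral_congr_ae ?_
  filter_upwards [hw.coeFn_toLp] with x hx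
  rw [hx]
  simp [RCLike.inner_apply, mul_comm]

/-- Reality makes the conjugated density and constant represent the same functional; averaging both
representations leaves real parts. -/
theorem WNeg.IsReal.exists_density {q : WNeg} (hq : q.IsReal) : ∃ (u : ℝ → ℝ) (k : ℝ),
    MemLp u 2 vol01 ∧
    ∀ w : W21, q.pairing w = k * extend01 w 0 + ∫ x, (u x : ℂ) * deriv01 w x ∂vol01 := by
  obtain ⟨v, c, hv, h⟩ := q.exists_density
  refine ⟨fun x => (v x).re, c.re, hv.re, fun w => ?_⟩
  have h1 : q.pairing w = star c * extend01 w 0 + ∫ x, star (v x) * deriv01 w x ∂vol01 := by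
    have h2 := hq w
    rw [h, extend01_star] at h2
    rw [← star_star (q.pairing w), ← h2, star_add, star_mul', star_star]
    congr 1
    change (starRingEnd ℂ) _ = _
    rw [← integral_conj]
    refine integral_congr_ae ?_
    filter_upwards [deriv01_star w] with x hx
    rw [hx]
    simp
  have i1 : Integrable (fun x => v x * deriv01 w x) vol01 := hv.integrable_mul (memLp_deriv01 w)
  have i2 : Integrable (fun x => star (v x) * deriv01 w x) vol01 :=
    hv.star.integrable_mul (memLp_deriv01 w)
  have h3 : ∫ x, (((v x).re : ℝ) : ℂ) * deriv01 w x ∂vol01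
      = (1 / 2) * (∫ x, v x * deriv01 w x ∂vol01 + ∫ x, star (v x) * deriv01 w x ∂vol01) := by
    rw [← integral_add i1 i2, ← integral_const_mul]
    refine integral_congr_ae (Filter.Eventually.of_forall fun x => ?_)
    simp only [Complex.re_eq_add_conj, Complex.star_def]
    ring
  rw [h3, Complex.re_eq_add_conj]
  simp only [Complex.star_def] at h1 ⊢
  linear_combination (1 / 2 : ℂ) * h w + (1 / 2 : ℂ) * h1

theorem prim_re (y : W21) : Prim (fun t => (extend01 y t).re) (fun t => (deriv01 y t).re) := by
  refine ⟨(memLp_deriv01 y).re, fun t ht => ?_⟩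
  have hi := intervalIntegrable_of_integrable_vol01
    ((memLp_deriv01 y).integrable (by norm_num)) (s := 0) (by simp) ht
  have := Complex.reCLM.intervalIntegral_comp_comm hi
  simp only [Complex.reCLM_apply] at this
  simp only [this]
  rw [extend01_eq y ht, Complex.add_re]

theorem prim_im (y : W21) : Prim (fun t => (extend01 y t).im) (fun t => (deriv01 y t).im) := by
  refine ⟨(memLp_deriv01 y).im, fun t ht => ?_⟩
  have hi := intervalIntegrable_of_integrable_vol01
    ((memLp_deriv01 y).integrable (by norm_num)) (s := 0) (by simp) ht
  have := Complex.imCLM.intervalIntegral_comp_comm hi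
  simp only [Complex.imCLM_apply] at this
  simp only [this]
  rw [extend01_eq y ht, Complex.add_im]

/-- A real indefinite integral as an element of `W_2^1[0,1]`. -/
def Prim.toW21 {Z H : ℝ → ℝ} (hZ : Prim Z H) : W21 :=
  primitive (Z 0 : ℂ) (fun x => (H x : ℂ)) hZ.1.ofReal

theorem Prim.extend01_toW21 {Z H : ℝ → ℝ} (hZ : Prim Z H) {t : ℝ} (ht : t ∈ Icc (0 : ℝ) 1) :
    extend01 hZ.toW21 t = Z t := by
  rw [Prim.toW21, extend01_primitive _ _ ht, hZ.2 t ht, intervalIntegral.integral_ofReal,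
    Complex.ofReal_add]

theorem Prim.deriv01_toW21 {Z H : ℝ → ℝ} (hZ : Prim Z H) :
    deriv01 hZ.toW21 =ᵐ[vol01] fun x => (H x : ℂ) :=
  deriv01_primitive _ _

/-! ### The pencil in real coefficients, and the comparison of eigenfunctions. -/

namespace Problem

variable (S : Problem)

/-- As `U` is diagonal, the range of `U - 1` is a coordinate subspace, so membership is a Dirichlet
condition at each end where the diagonal entry is 1. -/
theorem mem_HU {y : W21} : y ∈ S.HU ↔
    (S.U 0 0 = 1 → extend01 y 0 = 0) ∧ (S.U 1 1 = 1 → extend01 y 1 = 0) := by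
  have h0 : extend01 y 0 = bdry y 0 := extend01_coe y 0
  have h1 : extend01 y 1 = bdry y 1 := extend01_coe y 1
  have hoff : S.U 0 1 = 0 ∧ S.U 1 0 = 0 := ⟨S.U_diag (by decide), S.U_diag (by decide)⟩
  rw [h0, h1]
  change bdry y ∈ LinearMap.range (S.U - 1).mulVecLin ↔ _
  constructor
  · rintro ⟨v, hv⟩
    rw [← hv]
    constructor <;> intro h <;>
      simp [h, hoff.1, hoff.2]
  · rintro ⟨g0, g1⟩
    refine ⟨![bdry y 0 / (S.U 0 0 - 1), bdry y 1 / (S.U 1 1 - 1)], ?_⟩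
    ext k
    fin_cases k
    · by_cases h : S.U 0 0 = 1
      · simp [h, hoff.1, g0 h]
      · simp [hoff.1, ← sub_one_mul, mul_div_cancel₀ _ (sub_ne_zero.2 h)]
    · by_cases h : S.U 1 1 = 1
      · simp [h, hoff.2, g1 h]
      · simp [hoff.2, ← sub_one_mul, mul_div_cancel₀ _ (sub_ne_zero.2 h)]

theorem exists_V (k : Fin 2) : ∃ v : ℝ, S.V k k = v := by
  simp only [V, Matrix.diagonal_apply_eq]
  split_ifs
  · exact ⟨0, by simp⟩
  · exact ⟨_, rfl⟩

theorem V_dotProduct (y z : W21) : (S.V *ᵥ bdry y) ⬝ᵥ star (bdry z)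
    = S.V 0 0 * (extend01 y 0 * star (extend01 z 0))
      + S.V 1 1 * (extend01 y 1 * star (extend01 z 1)) := by
  have h0 : extend01 y 0 = bdry y 0 := extend01_coe y 0
  have h1 : extend01 y 1 = bdry y 1 := extend01_coe y 1
  have h0' : extend01 z 0 = bdry z 0 := extend01_coe z 0
  have h1' : extend01 z 1 = bdry z 1 := extend01_coe z 1
  have hoff : S.V 0 1 = 0 ∧ S.V 1 0 = 0 := by
    constructor <;> exact Matrix.diagonal_apply_ne _ (by decide)
  rw [h0, h1, h0', h1']
  simp only [Matrix.mulVec, dotProduct, Fin.sum_univ_two, hoff.1, hoff.2, Pi.star_apply]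
  ring

/-- The real coefficients of the form of the pencil at a real point. -/
def coeff (μ : ℝ) : Coeff where
  p := S.p
  u x := S.q_real.exists_density.choose x - μ * S.r_real.exists_density.choose x
  -- The densities are normalized at 0, so the point terms of `q` and `r` enter only here and not in
  -- `k₁`.
  k₀ := S.q_real.exists_density.choose_spec.choose - μ * S.r_real.exists_density.choose_spec.choose
    + (S.exists_V 0).choose
  k₁ := (S.exists_V 1).choose
  c := S.p_unif_pos.choose
  c_pos := S.p_unif_pos.choose_spec.1
  p_memLp := S.p_memLp
  u_memLp := S.q_real.exists_density.choose_spec.choose_spec.1.sub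
    (S.r_real.exists_density.choose_spec.choose_spec.1.const_mul μ)
  le_p := S.p_unif_pos.choose_spec.2

/-- The form is affine in the spectral parameter; `R` is the pairing of `r` with `Z²`. -/
theorem form_coeff_sub {Z H : ℝ → ℝ} (hZ : Prim Z H) : ∃ R : ℝ, ∀ μ ν : ℝ,
    (S.coeff μ).form Z H Z H - (S.coeff ν).form Z H Z H = (ν - μ) * R := by
  have hr := S.r_real.exists_density.choose_spec.choose_spec.1
  refine ⟨∫ x, S.r_real.exists_density.choose x * (H x * Z x + Z x * H x) ∂vol01
    + S.r_real.exists_density.choose_spec.choose * (Z 0 * Z 0), fun μ ν => ?_⟩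
  have h1 : ∫ x, (S.coeff μ).integrand Z H Z H x ∂vol01
      - ∫ x, (S.coeff ν).integrand Z H Z H x ∂vol01
      = (ν - μ) * ∫ x, S.r_real.exists_density.choose x * (H x * Z x + Z x * H x) ∂vol01 := by
    rw [← integral_sub ((S.coeff μ).integrable_integrand hZ hZ)
      ((S.coeff ν).integrable_integrand hZ hZ), ← integral_const_mul]
    refine integral_congr_ae (Filter.Eventually.of_forall fun x => ?_)
    simp only [Coeff.integrand, coeff]
    ring
  have h2 : (S.coeff μ).k₀ - (S.coeff ν).k₀
      = (ν - μ) * S.r_real.exists_density.choose_spec.choose := by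
    simp only [coeff]; ring
  have h3 : (S.coeff μ).k₁ = (S.coeff ν).k₁ := rfl
  simp only [Coeff.form]
  rw [h3]
  linear_combination h1 + (Z 0 * Z 0) * h2

/-- The element of `H_U` defined by a real indefinite integral. -/
def toHU {Z H : ℝ → ℝ} (hZ : Prim Z H) (h0 : S.U 0 0 = 1 → Z 0 = 0) (h1 : S.U 1 1 = 1 → Z 1 = 0) :
    S.HU :=
  ⟨hZ.toW21, S.mem_HU.2
    ⟨fun h => by rw [hZ.extend01_toW21 (by simp), h0 h, Complex.ofReal_zero],
      fun h => by rw [hZ.extend01_toW21 (by simp), h1 h, Complex.ofReal_zero]⟩⟩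

/-- Real test functions suffice: against them, the real and imaginary parts of the form are the real
forms of the real and imaginary parts of `y`. -/
theorem form_toHU (μ : ℝ) (y : S.HU) {Z H : ℝ → ℝ} (hZ : Prim Z H) (h0 : S.U 0 0 = 1 → Z 0 = 0)
    (h1 : S.U 1 1 = 1 → Z 1 = 0) :
    S.form μ y (S.toHU hZ h0 h1) =
      ∫ x, ((S.p x : ℂ) * deriv01 (y : W21) x * H x + ((S.coeff μ).u x : ℂ) *
        (deriv01 (y : W21) x * Z x + extend01 (y : W21) x * H x)) ∂vol01
      + (S.coeff μ).k₀ * (extend01 (y : W21) 0 * Z 0)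
      + (S.coeff μ).k₁ * (extend01 (y : W21) 1 * Z 1) := by
  have hy := memLp_deriv01 (y : W21)
  have hyt := memLp_extend01 (y : W21)
  have hH : MemLp (fun x => (H x : ℂ)) 2 vol01 := hZ.1.ofReal
  have hZt : MemLp (fun x => (Z x : ℂ)) ∞ vol01 := hZ.memLp_top.ofReal
  have hp : MemLp (fun x => (S.p x : ℂ)) ∞ vol01 := S.p_memLp.ofReal
  have hprod : MemLp (fun x => deriv01 (y : W21) x * Z x + extend01 (y : W21) x * H x) 2 vol01 :=
    (hZt.mul' hy).add (hH.mul' hyt)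
  have hderiv : deriv01 ((y : W21) * star hZ.toW21) =ᵐ[vol01]
      fun x => deriv01 (y : W21) x * Z x + extend01 (y : W21) x * H x := by
    filter_upwards [deriv01_mul (y : W21) (star hZ.toW21), deriv01_star hZ.toW21,
      hZ.deriv01_toW21, ae_restrict_mem measurableSet_Icc] with x e1 e2 e3 hx
    rw [e1, e2, e3, extend01_star, hZ.extend01_toW21 hx]
    simp
  have hpair : ∀ {f : WNeg} (hf : f.IsReal), f.pairing ((y : W21) * star hZ.toW21)
      = hf.exists_density.choose_spec.choose * (extend01 (y : W21) 0 * Z 0)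
        + ∫ x, (hf.exists_density.choose x : ℂ) *
          (deriv01 (y : W21) x * Z x + extend01 (y : W21) x * H x) ∂vol01 := by
    intro f hf
    rw [hf.exists_density.choose_spec.choose_spec.2, extend01_mul, extend01_star,
      hZ.extend01_toW21 (by simp)]
    congr 1
    · simp
    · refine integral_congr_ae ?_
      filter_upwards [hderiv] with x hx
      rw [hx]
  have hfirst : ∫ t in (0 : ℝ)..1, (S.p t : ℂ) * deriv01 (y : W21) t * star (deriv01 hZ.toW21 t)
      = ∫ x, (S.p x : ℂ) * deriv01 (y : W21) x * H x ∂vol01 := by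
    rw [← integral_vol01]
    refine integral_congr_ae ?_
    filter_upwards [hZ.deriv01_toW21] with x hx
    rw [hx]
    simp
  have iq : Integrable (fun x => (S.q_real.exists_density.choose x : ℂ) *
      (deriv01 (y : W21) x * Z x + extend01 (y : W21) x * H x)) vol01 :=
    S.q_real.exists_density.choose_spec.choose_spec.1.ofReal.integrable_mul hprod
  have ir : Integrable (fun x => (S.r_real.exists_density.choose x : ℂ) *
      (deriv01 (y : W21) x * Z x + extend01 (y : W21) x * H x)) vol01 :=
    S.r_real.exists_density.choose_spec.choose_spec.1.ofReal.integrable_mul hprod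
  have ip : Integrable (fun x => (S.p x : ℂ) * deriv01 (y : W21) x * H x) vol01 :=
    (hy.mul' hp : MemLp (fun x => (S.p x : ℂ) * deriv01 (y : W21) x) 2 vol01).integrable_mul hH
  have hsum : ∫ x, ((S.p x : ℂ) * deriv01 (y : W21) x * H x + ((S.coeff μ).u x : ℂ) *
      (deriv01 (y : W21) x * Z x + extend01 (y : W21) x * H x)) ∂vol01
      = ∫ x, (S.p x : ℂ) * deriv01 (y : W21) x * H x ∂vol01
        + (∫ x, (S.q_real.exists_density.choose x : ℂ) *
          (deriv01 (y : W21) x * Z x + extend01 (y : W21) x * H x) ∂vol01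
        - μ * ∫ x, (S.r_real.exists_density.choose x : ℂ) *
          (deriv01 (y : W21) x * Z x + extend01 (y : W21) x * H x) ∂vol01) := by
    have iqr : Integrable (fun x => (S.q_real.exists_density.choose x : ℂ) *
        (deriv01 (y : W21) x * Z x + extend01 (y : W21) x * H x) -
        μ * ((S.r_real.exists_density.choose x : ℂ) *
        (deriv01 (y : W21) x * Z x + extend01 (y : W21) x * H x))) vol01 := iq.sub (ir.const_mul _)
    rw [← integral_const_mul, ← integral_sub iq (ir.const_mul _), ← integral_add ip iqr]
    refine integral_congr_ae (Filter.Eventually.of_forall fun x => ?_)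
    simp only [coeff, Complex.ofReal_sub, Complex.ofReal_mul]
    ring
  have hk₀ : ((S.coeff μ).k₀ : ℂ) = S.q_real.exists_density.choose_spec.choose
      - μ * S.r_real.exists_density.choose_spec.choose + S.V 0 0 := by
    rw [(S.exists_V 0).choose_spec]
    simp only [coeff]
    push_cast
    ring
  have hk₁ : ((S.coeff μ).k₁ : ℂ) = S.V 1 1 := (S.exists_V 1).choose_spec.symm
  have hV := S.V_dotProduct y hZ.toW21
  rw [hZ.extend01_toW21 (by simp), hZ.extend01_toW21 (by simp)] at hV
  simp only [Complex.star_def, Complex.conj_ofReal] at hV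
  simp only [form, toHU]
  rw [hfirst, hpair S.q_real, hpair S.r_real, hV, hsum, hk₀, hk₁]
  ring

theorem integrable_form_toHU (μ : ℝ) (y : W21) {Z H : ℝ → ℝ} (hZ : Prim Z H) :
    Integrable (fun x => (S.p x : ℂ) * deriv01 y x * H x + ((S.coeff μ).u x : ℂ) *
      (deriv01 y x * Z x + extend01 y x * H x)) vol01 := by
  have hy := memLp_deriv01 y
  have hyt := memLp_extend01 y
  have hH : MemLp (fun x => (H x : ℂ)) 2 vol01 := hZ.1.ofReal
  have hZt : MemLp (fun x => (Z x : ℂ)) ∞ vol01 := hZ.memLp_top.ofReal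
  have hp : MemLp (fun x => (S.p x : ℂ)) ∞ vol01 := S.p_memLp.ofReal
  have hprod : MemLp (fun x => deriv01 y x * Z x + extend01 y x * H x) 2 vol01 :=
    (hZt.mul' hy).add (hH.mul' hyt)
  exact ((hy.mul' hp : MemLp (fun x => (S.p x : ℂ) * deriv01 y x) 2 vol01).integrable_mul hH).add
    ((S.coeff μ).u_memLp.ofReal.integrable_mul hprod)

theorem form_toHU_re (μ : ℝ) (y : S.HU) {Z H : ℝ → ℝ} (hZ : Prim Z H)
    (h0 : S.U 0 0 = 1 → Z 0 = 0) (h1 : S.U 1 1 = 1 → Z 1 = 0) :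
    (S.form μ y (S.toHU hZ h0 h1)).re = (S.coeff μ).form (fun t => (extend01 (y : W21) t).re)
      (fun t => (deriv01 (y : W21) t).re) Z H := by
  have h := Complex.reCLM.integral_comp_comm (S.integrable_form_toHU μ (y : W21) hZ)
  simp only [Complex.reCLM_apply] at h
  rw [form_toHU, Complex.add_re, Complex.add_re, ← h, Coeff.form]
  congr 2
  · refine integral_congr_ae (Filter.Eventually.of_forall fun x => ?_)
    simp [Coeff.integrand, coeff]
  · simp
  · simp

theorem form_toHU_im (μ : ℝ) (y : S.HU) {Z H : ℝ → ℝ} (hZ : Prim Z H)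
    (h0 : S.U 0 0 = 1 → Z 0 = 0) (h1 : S.U 1 1 = 1 → Z 1 = 0) :
    (S.form μ y (S.toHU hZ h0 h1)).im = (S.coeff μ).form (fun t => (extend01 (y : W21) t).im)
      (fun t => (deriv01 (y : W21) t).im) Z H := by
  have h := Complex.imCLM.integral_comp_comm (S.integrable_form_toHU μ (y : W21) hZ)
  simp only [Complex.imCLM_apply] at h
  rw [form_toHU, Complex.add_im, Complex.add_im, ← h, Coeff.form]
  congr 2
  · refine integral_congr_ae (Filter.Eventually.of_forall fun x => ?_)
    simp [Coeff.integrand, coeff]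
  · simp
  · simp

theorem form_coeff_pos {ξ : ℝ} (hξ : S.Positive ξ) {Z H : ℝ → ℝ} (hZ : Prim Z H)
    (h0 : S.U 0 0 = 1 → Z 0 = 0) (h1 : S.U 1 1 = 1 → Z 1 = 0)
    (hne : ∃ t ∈ Icc (0 : ℝ) 1, Z t ≠ 0) : 0 < (S.coeff ξ).form Z H Z H := by
  have h : S.toHU hZ h0 h1 ≠ 0 := by
    intro h
    obtain ⟨t, ht, hZt⟩ := hne
    have h2 : extend01 (S.toHU hZ h0 h1 : W21) t = extend01 0 t := by rw [h]; rfl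
    rw [show (S.toHU hZ h0 h1 : W21) = hZ.toW21 from rfl, hZ.extend01_toW21 ht] at h2
    exact hZt (Complex.ofReal_eq_zero.1 h2)
  have h2 := hξ _ h
  rw [form_toHU_re] at h2
  have e : ∀ t ∈ Icc (0 : ℝ) 1, (extend01 (S.toHU hZ h0 h1 : W21) t).re = Z t := fun t ht => by
    rw [show (S.toHU hZ h0 h1 : W21) = hZ.toW21 from rfl, hZ.extend01_toW21 ht, Complex.ofReal_re]
  have h3 : ∫ x, (S.coeff ξ).integrand (fun t => (extend01 (S.toHU hZ h0 h1 : W21) t).re)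
      (fun t => (deriv01 (S.toHU hZ h0 h1 : W21) t).re) Z H x ∂vol01
      = ∫ x, (S.coeff ξ).integrand Z H Z H x ∂vol01 := by
    refine integral_congr_ae ?_
    filter_upwards [hZ.deriv01_toW21, ae_restrict_mem measurableSet_Icc] with x hx hx'
    simp only [Coeff.integrand, e x hx']
    rw [show (S.toHU hZ h0 h1 : W21) = hZ.toW21 from rfl, hx, Complex.ofReal_re]
  rwa [Coeff.form, h3, e 0 (by simp), e 1 (by simp)] at h2

/-- An eigenfunction at a real point has the zeros of a real one. -/
theorem IsEigenfunction.exists_real {μ : ℝ} {y : S.HU} (hy : S.IsEigenfunction μ y) :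
    ∃ Y G : ℝ → ℝ, (S.coeff μ).IsSol (S.U 0 0 = 1) (S.U 1 1 = 1) Y G ∧
      (∀ t : I, Y t = 0 ↔ S.IsZero y t) ∧ ∃ t ∈ Icc (0 : ℝ) 1, Y t ≠ 0 := by
  have hmem := S.mem_HU.1 y.2
  have hre : (S.coeff μ).IsSol (S.U 0 0 = 1) (S.U 1 1 = 1)
      (fun t => (extend01 (y : W21) t).re) (fun t => (deriv01 (y : W21) t).re) :=
    { prim := prim_re _
      zero := fun h => by simp only [hmem.1 h, Complex.zero_re]
      one := fun h => by simp only [hmem.2 h, Complex.zero_re]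
      form_eq_zero := fun Z H hZ h0 h1 => by
        rw [← S.form_toHU_re μ y hZ h0 h1, hy.2, Complex.zero_re] }
  have him : (S.coeff μ).IsSol (S.U 0 0 = 1) (S.U 1 1 = 1)
      (fun t => (extend01 (y : W21) t).im) (fun t => (deriv01 (y : W21) t).im) :=
    { prim := prim_im _
      zero := fun h => by simp only [hmem.1 h, Complex.zero_im]
      one := fun h => by simp only [hmem.2 h, Complex.zero_im]
      form_eq_zero := fun Z H hZ h0 h1 => by
        rw [← S.form_toHU_im μ y hZ h0 h1, hy.2, Complex.zero_im] }
  obtain ⟨Y, G, hY, hzero⟩ := hre.exists_zero_iff him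
  have hiff : ∀ t : I, Y t = 0 ↔ S.IsZero y t := fun t => by
    rw [hzero t t.2, IsZero, ← extend01_coe, Complex.ext_iff]
    rfl
  refine ⟨Y, G, hY, hiff, ?_⟩
  by_contra! h
  refine hy.1 (Subtype.ext (Subtype.ext (funext fun t => ?_)))
  exact (hiff t).1 (h t t.2)

theorem lt_of_isEigenvalueAbove {ξ lam lam' : ℝ} {n : ℕ} (h : S.IsEigenvalueAbove ξ n lam)
    (h' : S.IsEigenvalueAbove ξ (n + 1) lam') : lam < lam' := by
  by_contra! hle
  have h1 : {ν : ℝ | ν ∈ Ioo ξ lam' ∧ S.IsEigenvalue (ν : ℂ)}.encard + 1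
      ≤ {ν : ℝ | ν ∈ Ioo ξ lam ∧ S.IsEigenvalue (ν : ℂ)}.encard + 1 := by
    gcongr
  have h2 : ((n + 1 : ℕ) : ℕ∞) ≤ (n : ℕ∞) := h'.2.2 ▸ h.2.2 ▸ h1
  exact absurd (Nat.cast_le.1 h2) (by omega)

/-- Allowing an end of [0,1] in place of a zero covers both claims of the theorem at once. -/
theorem exists_zero_between {ξ : ℝ} (hξ : S.Positive ξ) {lam lam' : ℝ} (h : ξ < lam)
    (h' : lam < lam') {y y' : S.HU} (hy : S.IsEigenfunction (lam : ℂ) y)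
    (hy' : S.IsEigenfunction (lam' : ℂ) y') {a b : I} (hab : a < b)
    (ha : a = 0 ∨ S.IsZero y a) (hb : b = 1 ∨ S.IsZero y b) :
    ∃ c : I, a < c ∧ c < b ∧ S.IsZero y' c := by
  obtain ⟨η, E, hη, hη0, hηne⟩ := hy.exists_real
  obtain ⟨Y, G, hY, hY0, -⟩ := hy'.exists_real
  have ha' : (a : ℝ) = 0 ∨ η a = 0 := ha.imp (fun h => by rw [h]; rfl) (hη0 a).2
  have hb' : (b : ℝ) = 1 ∨ η b = 0 := hb.imp (fun h => by rw [h]; rfl) (hη0 b).2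
  have hz := hη.prim.cutoff hab.le a.2.1 b.2.2 ha' hb'
  have hz0 : S.U 0 0 = 1 → (Icc (a : ℝ) b).indicator η 0 = 0 :=
    fun h => indicator_apply_eq_zero.2 fun _ => hη.zero h
  have hz1 : S.U 1 1 = 1 → (Icc (a : ℝ) b).indicator η 1 = 0 :=
    fun h => indicator_apply_eq_zero.2 fun _ => hη.one h
  have hzne : ∃ t ∈ Icc (0 : ℝ) 1, (Icc (a : ℝ) b).indicator η t ≠ 0 := by
    -- If the cutoff vanished, so would `η` on `[a,b]`, and unique continuation would make it vanish
    -- everywhere.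
    by_contra! h0
    obtain ⟨t, ht, hne⟩ := hηne
    refine hne (hη.weakSol.eq_zero_of_Icc hη.prim a.2.1 hab b.2.2 (fun s hs => ?_) t ht)
    rw [← h0 s ⟨a.2.1.trans hs.1, hs.2.trans b.2.2⟩, indicator_of_mem hs]
  have hpos := S.form_coeff_pos hξ hz hz0 hz1 hzne
  have hzero := hη.form_eq_zero _ _ hz hz0 hz1
  rw [← Coeff.form_cutoff_self] at hzero
  obtain ⟨R, hR⟩ := S.form_coeff_sub hz
  have h1 := hR ξ lam
  have h2 := hR lam' lam
  -- The form at `lam` vanishes on the cutoff, so its positive value at `ξ` is `(lam - ξ) * R`, and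
  -- its value at `lam'` is `(lam - lam') * R < 0`.
  have hRpos : 0 < R := by
    rw [hzero, sub_zero] at h1
    rw [h1] at hpos
    exact pos_of_mul_pos_right hpos (sub_pos.2 h).le
  obtain ⟨t, ht, hYt⟩ := hY.exists_zero hη.prim hη.zero hη.one hab a.2.1 b.2.2 ha' hb'
    (by rw [hzero, sub_zero] at h2; rw [h2]; exact mul_neg_of_neg_of_pos (sub_neg.2 h') hRpos)
  exact ⟨⟨t, a.2.1.trans ht.1.le, ht.2.le.trans b.2.2⟩, ht.1, ht.2, (hY0 _).1 hYt⟩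

end Problem

end SturmLiouville

end

theorem mainTheorem3 (S : SturmLiouville.Problem) (ξ : ℝ) (hξ : S.Positive ξ)
    (n : ℕ) (hn : 2 ≤ n) (lam lam' : ℝ)
    (hlam : S.IsEigenvalueAbove ξ n lam) (hlam' : S.IsEigenvalueAbove ξ (n + 1) lam')
    (y y' : S.HU) (hy : S.IsEigenfunction (lam : ℂ) y) (hy' : S.IsEigenfunction (lam' : ℂ) y') :
    (∀ a b : I, a < b → S.IsZero y a → S.IsZero y b →
      ∃ c : I, a < c ∧ c < b ∧ S.IsZero y' c) ∧
    (∀ a : I, S.IsZero y a →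
      (0 < a → ∃ c : I, 0 < c ∧ c < a ∧ S.IsZero y' c) ∧
      (a < 1 → ∃ c : I, a < c ∧ c < 1 ∧ S.IsZero y' c)) := by
  have hlt := S.lt_of_isEigenvalueAbove hlam hlam'
  exact ⟨fun a b hab ha hb =>
      S.exists_zero_between hξ hlam.1 hlt hy hy' hab (Or.inr ha) (Or.inr hb),
    fun a ha => ⟨fun h => S.exists_zero_between hξ hlam.1 hlt hy hy' h (Or.inl rfl) (Or.inr ha),
      fun h => S.exists_zero_between hξ hlam.1 hlt hy hy' h (Or.inr ha) (Or.inl rfl)⟩⟩
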